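/- Conventions. For $K\ge 1$, $\epsilon,C\ge 0$, a $(K,\epsilon)$ quasi-isometric embedding of metric spaces $q:X\to Y$ is a map with $\frac1K d_X(x,y)-\epsilon\le d_Y(q(x),q(y))\le K d_X(x,y)+\epsilon$; it is a $(K,\epsilon,C)$ quasi-isometry if moreover every point of $Y$ is within $C$ of $q(X)$. A quasi-action of a group $G$ on a metric space $X$ is a map $\alpha:G\times X\to X$ for which there are $K\ge1$, $\epsilon,C\ge0$ such that each $\alpha(g,\cdot)$ is a $(K,\epsilon,C)$ quasi-isometry of $X$, $d(\alpha(1,x),x)\le C$ and $d(\alpha(g,\alpha(h,x)),\alpha(gh,x))\le C$ for all $g,h\in G$, $x\in X$. An element $g\in G$ is elliptic for $\alpha$ if $\{\alpha(g^n,x_0): n\in\mathbb Z\}$ is bounded for some (equivalently any) $x_0\in X$. A quasi-action $\alpha$ of $G$ on $X$ reduces to a quasi-action $\beta$ of $G$ on $Y$ if there are a quasi-isometric embedding $F:Y\to X$ and $M\ge 0$ with $d_X(F(\beta(g,y)),\alpha(g,F(y)))\le M$ for all $g\in G$, $y\in Y$. A hyperbolic space is a non-empty geodesic metric space that is $\delta$-hyperbolic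 for some $\delta$ (it need not be proper); it has a Gromov boundary $\partial X$. For an isometric action of $G$ on a hyperbolic space $X$, the limit set $\partial_GX\subseteq\partial X$ is the set of accumulation points in $\partial X$ of an orbit. The action is of type (3)$^+$ if $\partial_GX$ consists of exactly two points and $G$ fixes both, and of type (3)$^-$ if $\partial_GX$ consists of exactly two points and $G$ does not fix both. An isometric action of $G$ on $\mathbb R$ is a translation action if $g\cdot x=x+\theta(g)$ for a homomorphism $\theta:G\to\mathbb R$; it is dihedral if there are an index $2$ subgroup $H$ of $G$, an element $t\in G\setminus H$ and a homomorphism $\theta:H\to\mathbb R$ with $\theta(shs^{-1})=-\theta(h)$ for all $h\in H$, $s\in G\setminus H$, such that $h\cdot x=x+\theta(h)$ and $(th)\cdot x=-x-\theta(h)$ for all $h\in H$, $x\in\mathbb R$. Theorem. Let $\alpha$ be a quasi-action of a group $G$ on a metric space and let $E\subseteq G$ be its set of elliptic elements. (a) Suppose that $\alpha$ reduces to an isometric action of type (3)$^+$ on some hyperbolic space. Then $\alpha$ reduces to an isometric translation action of $G$ on $\mathbb R$ if and only if $E=\ker\theta$ for some homomorphism $\theta:G\to\mathbb R$. If $E$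 is not the kernel of any homomorphism $G\to\mathbb R$, then $\alpha$ does not reduce to any isometric action of $G$ on a hyperbolic space that is proper or CAT(0). (b) Suppose that $\alpha$ reduces to an isometric action of type (3)$^-$ on some hyperbolic space. Then $\alpha$ reduces to an isometric dihedral action of $G$ on $\mathbb R$ if and only if there are an index $2$ subgroup $H$ of $G$ and a homomorphism $\theta:H\to\mathbb R$ with $E=\ker\theta\cup(G\setminus H)$. If there are no such $H$ and $\theta$, then $\alpha$ does not reduce to any isometric action of $G$ on a hyperbolic space that is proper or CAT(0). -/

import Mathlib

open Filter Topology

universe u v w t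

/-! ### Quasi-isometries and quasi-actions -/

/-- `q` is a `(K, ε)` quasi-isometric embedding of metric spaces. -/
structure IsQIEmbeddingWith {X : Type v} {Y : Type w} [MetricSpace X] [MetricSpace Y]
    (K ε : ℝ) (q : X → Y) : Prop where
  one_le : 1 ≤ K
  nonneg : 0 ≤ ε
  lower : ∀ x y : X, (1 / K) * dist x y - ε ≤ dist (q x) (q y)
  upper : ∀ x y : X, dist (q x) (q y) ≤ K * dist x y + ε

/-- `q` is a quasi-isometric embedding. -/
def IsQIEmbedding {X : Type v} {Y : Type w} [MetricSpace X] [MetricSpace Y] (q : X → Y) : Prop :=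
  ∃ K ε : ℝ, IsQIEmbeddingWith K ε q

/-- `q` is a `(K, ε, C)` quasi-isometry: a `(K, ε)` quasi-isometric embedding which is
`C`-coarse onto. -/
structure IsQuasiIsometryWith {X : Type v} {Y : Type w} [MetricSpace X] [MetricSpace Y]
    (K ε C : ℝ) (q : X → Y) : Prop where
  embedding : IsQIEmbeddingWith K ε q
  coarse_onto : 0 ≤ C ∧ ∀ y : Y, ∃ x : X, dist y (q x) ≤ C

/-- `α : G × X → X` (curried) is a `(K, ε, C)` quasi-action of the group `G` on `X`. -/
structure IsQuasiActionWith {G : Type u} [Group G] {X : Type v} [MetricSpace X]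
    (K ε C : ℝ) (α : G → X → X) : Prop where
  quasiIsometry : ∀ g : G, IsQuasiIsometryWith K ε C (α g)
  one_close : ∀ x : X, dist (α 1 x) x ≤ C
  mul_close : ∀ (g h : G) (x : X), dist (α g (α h x)) (α (g * h) x) ≤ C

/-- `α` is a quasi-action: a `(K, ε, C)` quasi-action for some `K ≥ 1`, `ε, C ≥ 0`. -/
def IsQuasiAction {G : Type u} [Group G] {X : Type v} [MetricSpace X] (α : G → X → X) : Prop :=
  ∃ K ε C : ℝ, 1 ≤ K ∧ 0 ≤ ε ∧ 0 ≤ C ∧ IsQuasiActionWith K ε C α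

/-- A genuine action regarded as a map `G → X → X`. -/
def actionMap (G : Type u) [Group G] (X : Type v) [MulAction G X] : G → X → X :=
  fun g x => g • x

/-- An element `g` is elliptic for `α` if the restriction of `α` to `⟨g⟩` is bounded. -/
def IsElliptic {G : Type u} [Group G] {X : Type v} [MetricSpace X] (α : G → X → X) (g : G) :
    Prop :=
  ∃ x₀ : X, Bornology.IsBounded (Set.range fun n : ℤ => α (g ^ n) x₀)

/-- `F` is coarse `G`-equivariant from `α` to `β`. -/
def IsCoarseEquivariant {G : Type u} [Group G] {X : Type v} {Y : Type w} [MetricSpace X]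
    [MetricSpace Y] (α : G → X → X) (β : G → Y → Y) (F : X → Y) : Prop :=
  ∃ M : ℝ, 0 ≤ M ∧ ∀ (g : G) (x : X), dist (F (α g x)) (β g (F x)) ≤ M

/-- The quasi-action `α` (on `X`) reduces to the quasi-action `β` (on `Y`): there is a coarse
`G`-equivariant quasi-isometric embedding of `Y` in `X`, from `β` to `α`. -/
def ReducesTo {G : Type u} [Group G] {X : Type v} {Y : Type w} [MetricSpace X] [MetricSpace Y]
    (α : G → X → X) (β : G → Y → Y) : Prop :=
  ∃ F : Y → X, IsQIEmbedding F ∧ IsCoarseEquivariant β α F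

/-! ### Geodesic, hyperbolic and CAT(0) spaces -/

/-- `γ`, restricted to `[0, dist x y]`, is a geodesic from `x` to `y`. -/
def IsGeodesicFromTo {X : Type v} [MetricSpace X] (γ : ℝ → X) (x y : X) : Prop :=
  γ 0 = x ∧ γ (dist x y) = y ∧
    ∀ s ∈ Set.Icc 0 (dist x y), ∀ r ∈ Set.Icc 0 (dist x y), dist (γ s) (γ r) = |s - r|

/-- Any two points are joined by a geodesic. -/
def IsGeodesicSpace (X : Type v) [MetricSpace X] : Prop :=
  ∀ x y : X, ∃ γ : ℝ → X, IsGeodesicFromTo γ x y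

/-- The Gromov product `(x | y)_b`. -/
noncomputable def gromovProduct {X : Type v} [MetricSpace X] (b x y : X) : ℝ :=
  (dist b x + dist b y - dist x y) / 2

/-- A hyperbolic space: a non-empty geodesic metric space that is `δ`-hyperbolic for some `δ`.
No properness is assumed. -/
class IsHyperbolicSpace (X : Type v) [MetricSpace X] : Prop where
  nonempty : Nonempty X
  geodesic : IsGeodesicSpace X
  hyperbolic : ∃ δ : ℝ, 0 ≤ δ ∧ ∀ b x y z : X,
    min (gromovProduct b x y) (gromovProduct b y z) - δ ≤ gromovProduct b x z

/-- A CAT(0) space: a geodesic space in which, for each geodesic `γ` from `x` to `y` and each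
point `p`, the distance from `p` to a point of `γ` is at most the corresponding distance in the
Euclidean comparison triangle (whose square is the right-hand side, by Stewart's theorem). -/
structure IsCAT0Space (X : Type v) [MetricSpace X] : Prop where
  geodesic : IsGeodesicSpace X
  comparison : ∀ (x y p : X) (γ : ℝ → X), IsGeodesicFromTo γ x y → ∀ s ∈ Set.Icc (0 : ℝ) 1,
    dist p (γ (s * dist x y)) ^ 2 ≤
      (1 - s) * dist p x ^ 2 + s * dist p y ^ 2 - s * (1 - s) * dist x y ^ 2

/-! ### The Gromov boundary and limit sets -/

/-- `(x_i | y_j)_b → ∞` as `i, j → ∞`, for every base point `b`. -/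
def GromovConverges {X : Type v} [MetricSpace X] (x y : ℕ → X) : Prop :=
  ∀ b : X, Tendsto (fun p : ℕ × ℕ => gromovProduct b (x p.1) (y p.2)) atTop atTop

/-- The sequences in `X` that converge to infinity. -/
abbrev SeqToInfinity (X : Type v) [MetricSpace X] : Type v :=
  {x : ℕ → X // GromovConverges x x}

/-- Two sequences converging to infinity are equivalent if their mutual Gromov products tend
to infinity. -/
def boundarySetoid (X : Type v) [MetricSpace X] [IsHyperbolicSpace X] :
    Setoid (SeqToInfinity X) where
  r x y := GromovConverges x.1 y.1
  iseqv :=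
    { refl := fun x => x.2
      symm := by
        intro x y h b
        rw [tendsto_atTop_atTop]
        intro R
        obtain ⟨N, hN⟩ := tendsto_atTop_atTop.1 (h b) R
        refine ⟨N.swap, fun p hp => ?_⟩
        have := hN p.swap ⟨hp.2, hp.1⟩
        simp only [gromovProduct, Prod.fst_swap, Prod.snd_swap] at this ⊢
        rw [dist_comm (y.1 p.1) (x.1 p.2)]
        linarith
      trans := by
        intro x y z hxy hyz b
        obtain ⟨δ, -, hδ⟩ := IsHyperbolicSpace.hyperbolic (X := X)
        rw [tendsto_atTop_atTop]
        intro R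
        obtain ⟨N, hN⟩ := tendsto_atTop_atTop.1 (hxy b) (R + δ)
        obtain ⟨M, hM⟩ := tendsto_atTop_atTop.1 (hyz b) (R + δ)
        refine ⟨(N.1, M.2), fun p hp => ?_⟩
        have h1 := hN (p.1, max N.2 M.1) ⟨hp.1, le_max_left _ _⟩
        have h2 := hM (max N.2 M.1, p.2) ⟨le_max_right _ _, hp.2⟩
        have h3 := hδ b (x.1 p.1) (y.1 (max N.2 M.1)) (z.1 p.2)
        have h4 := le_min h1 h2
        simp only at h4 ⊢
        linarith }

/-- The Gromov boundary `∂X`. -/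
def GromovBoundary (X : Type v) [MetricSpace X] [IsHyperbolicSpace X] : Type v :=
  Quotient (boundarySetoid X)

/-- The boundary point represented by a sequence that converges to infinity. -/
def boundaryPoint {X : Type v} [MetricSpace X] [IsHyperbolicSpace X] (s : SeqToInfinity X) :
    GromovBoundary X :=
  Quotient.mk (boundarySetoid X) s

theorem GromovConverges.smul {G : Type u} [Group G] {X : Type v} [MetricSpace X]
    [MulAction G X] [IsIsometricSMul G X] (g : G) {x y : ℕ → X} (h : GromovConverges x y) :
    GromovConverges (fun n => g • x n) (fun n => g • y n) := by
  intro b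
  refine (h (g⁻¹ • b)).congr fun p => ?_
  have e : ∀ z : X, dist b (g • z) = dist (g⁻¹ • b) z := fun z => by
    rw [← dist_smul g (g⁻¹ • b) z, smul_inv_smul]
  simp only [gromovProduct, e, dist_smul]

/-- The map of `∂X` induced by the isometry `x ↦ g • x`. -/
def boundaryMap {G : Type u} [Group G] {X : Type v} [MetricSpace X] [IsHyperbolicSpace X]
    [MulAction G X] [IsIsometricSMul G X] (g : G) : GromovBoundary X → GromovBoundary X :=
  Quotient.map (sa := boundarySetoid X) (sb := boundarySetoid X)
    (fun x => (⟨fun n => g • x.1 n, x.2.smul g⟩ : SeqToInfinity X))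
    (fun _ _ h => GromovConverges.smul g h)

/-- The limit set `∂_G X`: the accumulation points in `∂X` of an orbit, that is, the boundary
points represented by a sequence in that orbit. -/
def limitSet (G : Type u) [Group G] (X : Type v) [MetricSpace X] [IsHyperbolicSpace X]
    [MulAction G X] : Set (GromovBoundary X) :=
  {ζ | ∃ (x₀ : X) (s : SeqToInfinity X), (∀ n, s.1 n ∈ MulAction.orbit G x₀) ∧
    ζ = boundaryPoint s}

/-! ### Lineal actions -/

/-- Type `(3)`: the limit set has exactly two points. -/
def IsLineal (G : Type u) [Group G] (X : Type v) [MetricSpace X] [IsHyperbolicSpace X]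
    [MulAction G X] : Prop :=
  (limitSet G X).encard = 2

/-- Type `(3)⁺`: the limit set has exactly two points and `G` fixes both of them. -/
def IsTypeThreePlus (G : Type u) [Group G] (X : Type v) [MetricSpace X] [IsHyperbolicSpace X]
    [MulAction G X] [IsIsometricSMul G X] : Prop :=
  IsLineal G X ∧ ∀ g : G, ∀ ζ ∈ limitSet G X, boundaryMap g ζ = ζ

/-- Type `(3)⁻`: the limit set has exactly two points and `G` does not fix both of them. -/
def IsTypeThreeMinus (G : Type u) [Group G] (X : Type v) [MetricSpace X] [IsHyperbolicSpace X]
    [MulAction G X] [IsIsometricSMul G X] : Prop :=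
  IsLineal G X ∧ ¬ ∀ g : G, ∀ ζ ∈ limitSet G X, boundaryMap g ζ = ζ

/-! ### Translation and dihedral actions on the real line -/

/-- The action of `G` on `ℝ` is by translations: `g • x = x + θ g` for a homomorphism
`θ : G → ℝ`. -/
def IsTranslationAction (G : Type u) [Group G] [MulAction G ℝ] : Prop :=
  ∃ θ : G →* Multiplicative ℝ, ∀ (g : G) (x : ℝ), g • x = x + (θ g).toAdd

/-- The action of `G` on `ℝ` is dihedral: for an index `2` subgroup `H`, an element `t ∉ H` and
a homomorphism `θ : H → ℝ` that is antisymmetric in `G`, the elements `h` and `t * h` (`h ∈ H`)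
act as `x ↦ x + θ h` and `x ↦ -x - θ h`. -/
def IsDihedralAction (G : Type u) [Group G] [MulAction G ℝ] : Prop :=
  ∃ (H : Subgroup G) (θ : H →* Multiplicative ℝ) (t : G), H.index = 2 ∧ t ∉ H ∧
    (∀ h h' : H, ∀ s : G, s ∉ H → (h' : G) = s * h * s⁻¹ → (θ h').toAdd = -(θ h).toAdd) ∧
    ∀ (h : H) (x : ℝ), (h : G) • x = x + (θ h).toAdd ∧ (t * (h : G)) • x = -x - (θ h).toAdd

/-! A reduction preserves the distance functions of orbits up to affine bounds, so ellipticity can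
be read off in any space to which `α` reduces. In a lineal action the Busemann function of one limit
point, evaluated along an orbit, gives a coordinate `b : G → ℝ` with `d(gy, ky)` within bounded
error of `|b g - b k|`. Elements fixing both ends act on `b` as coarse translations, elements
exchanging them as coarse reflections (`FourPoint.exists_coarseLine`). On the fixer of the ends `b`
is therefore an unbounded quasimorphism, and an element is elliptic exactly when `b` is bounded on
its powers.

If `E = ker θ`, then `b` is uniformly bounded on `ker θ`, which contains all commutators. Hence the
homogenization of `b` is additive, and `b` lies near a homomorphism `c`
(`IsQuasimorphism.exists_hom_of_ker`); translating by `c` realizes the reduction to `ℝ`. Conversely,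
the elliptic elements of a translation action form a kernel.

Suppose `α` also reduces to a hyperbolic space `Z`. A power of an element with large `b` is
loxodromic in `Z`, and the ends of its axis are fixed by every element on which `b` is a
quasimorphism (`FourPoint.exists_axis`). If `Z` is CAT(0), Busemann functions depend only on the
boundary point, so their change along the orbit is a homomorphism. If `Z` is proper, the closure of
the orbit carries an invariant Radon measure, built like Haar measure from covering numbers, and the
net measure that `g` moves across a level of the Busemann function is a homomorphism
(`exists_hom_of_height`). Either one vanishes exactly on the elliptic elements.

For type (3)⁻ this applies to the index `2` fixer `H` of the ends. Elements outside `H` reverse `b`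
coarsely, so they are elliptic, and `H` is determined by `E` (`subgroup_eq_of_elliptic`). -/

/-! ### Limits along a fixed ultrafilter -/

/-- The limit of a bounded real sequence along a fixed free ultrafilter. -/
noncomputable def ulim (f : ℕ → ℝ) : ℝ := limUnder (hyperfilter ℕ : Filter ℕ) f

/-- Ordinary limits of Busemann differences need not exist in a hyperbolic space; ultrafilter limits
of bounded sequences always do, and remain additive. -/
theorem tendsto_ulim {f : ℕ → ℝ} {C : ℝ} (h : ∀ n, |f n| ≤ C) :
    Tendsto f (hyperfilter ℕ : Filter ℕ) (𝓝 (ulim f)) := by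
  apply tendsto_nhds_limUnder
  have hm : Set.Icc (-C) C ∈ (hyperfilter ℕ).map f :=
    Filter.mem_map.2 (Filter.univ_mem' fun n => abs_le.1 (h n))
  obtain ⟨x, -, hx⟩ := isCompact_Icc.ultrafilter_le_nhds ((hyperfilter ℕ).map f)
    (le_principal_iff.2 hm)
  exact ⟨x, hx⟩

theorem Filter.Eventually.hyperfilter {p : ℕ → Prop} (h : ∀ᶠ n in atTop, p n) :
    ∀ᶠ n in (Filter.hyperfilter ℕ : Filter ℕ), p n :=
  h.filter_mono Nat.hyperfilter_le_atTop

/-! ### Four-point hyperbolicity -/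

section Coarse

variable {Y : Type w} [MetricSpace Y]

/-- The Gromov four-point condition with constant `δ`. -/
def FourPoint (Y : Type w) [MetricSpace Y] (δ : ℝ) : Prop :=
  ∀ b x y z : Y, min (gromovProduct b x y) (gromovProduct b y z) - δ ≤ gromovProduct b x z

theorem gromovProduct_comm (b x y : Y) : gromovProduct b x y = gromovProduct b y x := by
  simp only [gromovProduct, dist_comm x y]; ring

theorem gromovProduct_nonneg (b x y : Y) : 0 ≤ gromovProduct b x y := by
  have := dist_triangle_left x y b
  simp only [gromovProduct]; linarith

theorem gromovProduct_self (b x : Y) : gromovProduct b x x = dist b x := by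
  simp [gromovProduct]

theorem gromovProduct_le_add_dist (b c x y : Y) :
    gromovProduct b x y ≤ gromovProduct c x y + dist b c := by
  have h1 := dist_triangle b c x
  have h2 := dist_triangle b c y
  simp only [gromovProduct]; linarith

theorem gromovProduct_smul {G : Type u} [Group G] [MulAction G Y] [IsIsometricSMul G Y] (g : G)
    (b x y : Y) : gromovProduct (g • b) (g • x) (g • y) = gromovProduct b x y := by
  simp only [gromovProduct, dist_smul]

theorem FourPoint.dist_add_le {δ : ℝ} (h : FourPoint Y δ) (a c x y : Y) :
    dist a x + dist c y ≤ max (dist a c + dist x y) (dist a y + dist c x) + 2 * δ := by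
  have h0 := h a c x y
  simp only [gromovProduct] at h0
  rcases min_choice ((dist a c + dist a x - dist c x) / 2) ((dist a x + dist a y - dist x y) / 2)
    with h1 | h1
  · have := le_max_right (dist a c + dist x y) (dist a y + dist c x)
    linarith
  · have := le_max_left (dist a c + dist x y) (dist a y + dist c x)
    linarith

/-- Otherwise two four-point steps along `x, y, z, w`, each losing `δ`, would push `(x | w)` above
`R`. -/
theorem FourPoint.chain {δ : ℝ} (h : FourPoint Y δ) {b x y z w : Y} {R : ℝ} (hδ : 0 ≤ δ)
    (h1 : R + 2 * δ < gromovProduct b x y) (h3 : R + 2 * δ < gromovProduct b z w)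
    (h4 : gromovProduct b x w ≤ R) : gromovProduct b y z ≤ R + 2 * δ := by
  by_contra! h2
  have e1 := h b x y z
  have e2 := h b x z w
  have := lt_min h1 h2
  have := lt_min (show R + δ < gromovProduct b x z by linarith)
    (show R + δ < gromovProduct b z w by linarith)
  linarith

/-! ### Busemann functions along sequences -/

theorem GromovConverges.symm {x y : ℕ → Y} (h : GromovConverges x y) : GromovConverges y x := by
  intro b
  rw [tendsto_atTop_atTop]
  intro R
  obtain ⟨N, hN⟩ := tendsto_atTop_atTop.1 (h b) R
  refine ⟨N.swap, fun p hp => ?_⟩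
  have := hN p.swap ⟨hp.2, hp.1⟩
  rwa [gromovProduct_comm] at this

theorem GromovConverges.tendsto_diag {x y : ℕ → Y} (h : GromovConverges x y) (b : Y) :
    Tendsto (fun n => gromovProduct b (x n) (y n)) atTop atTop :=
  (h b).comp (tendsto_id.prodMk tendsto_id |>.mono_right (by rw [prod_atTop_atTop_eq]))

/-- The Busemann cocycle `lim d(a, u n) - d(x, u n)` of a sequence. -/
noncomputable def busemann (u : ℕ → Y) (a x : Y) : ℝ := ulim fun n => dist a (u n) - dist x (u n)

theorem tendsto_busemann (u : ℕ → Y) (a x : Y) :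
    Tendsto (fun n => dist a (u n) - dist x (u n)) (hyperfilter ℕ : Filter ℕ)
      (𝓝 (busemann u a x)) :=
  tendsto_ulim fun n => abs_dist_sub_le a x (u n)

theorem abs_busemann_le (u : ℕ → Y) (a x : Y) : |busemann u a x| ≤ dist a x :=
  le_of_tendsto (tendsto_busemann u a x).abs
    (Eventually.of_forall fun n => abs_dist_sub_le a x (u n))

theorem busemann_add (u : ℕ → Y) (a x y : Y) :
    busemann u a x + busemann u x y = busemann u a y := by
  refine tendsto_nhds_unique ((tendsto_busemann u a x).add (tendsto_busemann u x y))
    ((tendsto_busemann u a y).congr fun n => ?_)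
  ring

theorem busemann_smul {G : Type u} [Group G] [MulAction G Y] [IsIsometricSMul G Y] (g : G)
    (u : ℕ → Y) (a x : Y) :
    busemann (fun n => g • u n) (g • a) (g • x) = busemann u a x := by
  simp only [busemann, dist_smul]

/-- When `x` and `y` agree, seen from `a`, beyond the distance of `c`, the sum `d(a,c) + d(x,y)`
does not exceed `d(a,y) + d(c,x)`, which settles the maximum in the four-point inequality. -/
theorem FourPoint.dist_sub_le {δ : ℝ} (h : FourPoint Y δ) {a c x y : Y}
    (hxy : dist a c ≤ gromovProduct a x y) :
    dist a x - dist c x - (dist a y - dist c y) ≤ 2 * δ := by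
  have h1 := h.dist_add_le a c x y
  have h2 : dist a c + dist x y ≤ dist a y + dist c x := by
    have := dist_triangle a c x
    simp only [gromovProduct] at hxy
    linarith
  rw [max_eq_right h2] at h1
  linarith

/-- This ambiguity in the choice of representative is where the defect of the quasimorphism comes
from. -/
theorem FourPoint.abs_busemann_sub_le {δ : ℝ} (h : FourPoint Y δ) {x y : ℕ → Y}
    (hxy : GromovConverges x y) (a c : Y) :
    |busemann x a c - busemann y a c| ≤ 2 * δ := by
  refine le_of_tendsto ((tendsto_busemann x a c).sub (tendsto_busemann y a c)).abs ?_
  have := ((hxy.tendsto_diag a).eventually_ge_atTop (dist a c)).hyperfilter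
  filter_upwards [this] with n hn
  have h1 := h.dist_sub_le hn
  have h2 := h.dist_sub_le (x := y n) (y := x n) (a := a) (c := c)
    (by rwa [gromovProduct_comm])
  rw [abs_le]
  constructor <;> linarith

/-- The Gromov product of the two sequences, seen from `x`, is eventually at most `R`. -/
def NearAxis (R : ℝ) (u v : ℕ → Y) (x : Y) : Prop :=
  ∀ᶠ p : ℕ × ℕ in atTop, gromovProduct x (u p.1) (v p.2) ≤ R

theorem NearAxis.diag {R : ℝ} {u v : ℕ → Y} {x : Y} (h : NearAxis R u v x) :
    ∀ᶠ n in atTop, gromovProduct x (u n) (v n) ≤ R :=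
  ((tendsto_id.prodMk tendsto_id |>.mono_right (by rw [prod_atTop_atTop_eq])) :
    Tendsto (fun n : ℕ => (n, n)) atTop atTop).eventually h

theorem NearAxis.swap {R : ℝ} {u v : ℕ → Y} {x : Y} (h : NearAxis R u v x) :
    NearAxis R v u x := by
  obtain ⟨N, hN⟩ := eventually_atTop.1 h
  refine eventually_atTop.2 ⟨N.swap, fun p hp => ?_⟩
  rw [gromovProduct_comm]
  exact hN p.swap ⟨hp.2, hp.1⟩

/-- Since `(u | v)` is small at `x`, so is `(u | y)` or `(v | y)` there, and likewise at `y` with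
`x`. A small product with `u` gives the bound directly; two small products with `v` add up to `d(x,
y)`, which is then small itself. -/
theorem FourPoint.abs_dist_sub_busemann_le {δ R : ℝ} (h : FourPoint Y δ) {u v : ℕ → Y} {x y : Y}
    (hx : NearAxis R u v x) (hy : NearAxis R u v y) :
    |dist x y - (|busemann u x y|)| ≤ 2 * (R + δ) := by
  have h0 := abs_busemann_le u x y
  have h1 : dist x y - |busemann u x y| ≤ 2 * (R + δ) := by
    refine le_of_tendsto ((tendsto_busemann u x y).abs.const_sub _) ?_
    filter_upwards [hx.diag.hyperfilter, hy.diag.hyperfilter] with n h1 h2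
    have e1 := h x (u n) y (v n)
    have e2 := h y (u n) x (v n)
    have e3 := le_abs_self (dist x (u n) - dist y (u n))
    have e4 := neg_abs_le (dist x (u n) - dist y (u n))
    have e5 := abs_nonneg (dist x (u n) - dist y (u n))
    simp only [gromovProduct] at *
    rw [dist_comm (u n) y, dist_comm (u n) x, dist_comm y x] at *
    rcases min_choice ((dist x (u n) + dist x y - dist y (u n)) / 2)
        ((dist x y + dist x (v n) - dist y (v n)) / 2) with h3 | h3 <;>
      rcases min_choice ((dist y (u n) + dist x y - dist x (u n)) / 2)
        ((dist x y + dist y (v n) - dist x (v n)) / 2) with h4 | h4 <;>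
      rw [h3] at e1 <;> rw [h4] at e2 <;> linarith
  rw [abs_le]
  exact ⟨by linarith [abs_nonneg (busemann u x y), dist_nonneg (x := x) (y := y)], h1⟩

theorem NearAxis.nonneg {R : ℝ} {u v : ℕ → Y} {x : Y} (h : NearAxis R u v x) : 0 ≤ R := by
  obtain ⟨n, hn⟩ := h.diag.exists
  exact (gromovProduct_nonneg _ _ _).trans hn

theorem NearAxis.abs_busemann_add_le {R : ℝ} {u v : ℕ → Y} {x y : Y}
    (hx : NearAxis R u v x) (hy : NearAxis R u v y) :
    |busemann u x y + busemann v x y| ≤ 2 * R := by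
  refine le_of_tendsto ((tendsto_busemann u x y).add (tendsto_busemann v x y)).abs ?_
  filter_upwards [hx.diag.hyperfilter, hy.diag.hyperfilter] with n h1 h2
  have e1 := gromovProduct_nonneg x (u n) (v n)
  have e2 := gromovProduct_nonneg y (u n) (v n)
  simp only [gromovProduct] at *
  rw [abs_le]
  constructor <;> linarith

theorem FourPoint.nearAxis_of_gromovConverges {δ R : ℝ} (h : FourPoint Y δ) (hδ : 0 ≤ δ)
    {u v u' v' : ℕ → Y} {x : Y} (hx : NearAxis R u v x) (hu : GromovConverges u u')
    (hv : GromovConverges v v') : NearAxis (R + 2 * δ) u' v' x := by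
  have hu' := (hu.tendsto_diag x).eventually_gt_atTop (R + 2 * δ)
  have hv' := (hv.symm.tendsto_diag x).eventually_gt_atTop (R + 2 * δ)
  have hu2 := (tendsto_fst (f := atTop) (g := (atTop : Filter ℕ))).eventually hu'
  have hv2 := (tendsto_snd (f := (atTop : Filter ℕ)) (g := atTop)).eventually hv'
  rw [prod_atTop_atTop_eq] at hu2 hv2
  filter_upwards [hx, hu2, hv2] with p h1 h2 h3
  exact h.chain hδ h2 h3 h1

theorem FourPoint.exists_nearAxis {δ : ℝ} (h : FourPoint Y δ) (hδ : 0 ≤ δ) {u v : ℕ → Y}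
    (hu : GromovConverges u u) (hv : GromovConverges v v) (huv : ¬ GromovConverges u v) (x : Y) :
    ∃ R, NearAxis R u v x := by
  simp only [GromovConverges, not_forall] at huv
  obtain ⟨b, hb⟩ := huv
  rw [tendsto_atTop] at hb
  push Not at hb
  obtain ⟨R, hR⟩ := hb
  have key : NearAxis (R + 2 * δ) u v b := by
    obtain ⟨N, hN⟩ := eventually_atTop.1 ((hu b).eventually_gt_atTop (R + 2 * δ))
    obtain ⟨M, hM⟩ := eventually_atTop.1 ((hv b).eventually_gt_atTop (R + 2 * δ))
    -- A single pair far out with bounded product controls all far pairs, by `FourPoint.chain`.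
    obtain ⟨q, hq, hqR⟩ := frequently_atTop.1 hR
      (max N.1 N.2, max M.1 M.2)
    refine eventually_atTop.2 ⟨(max N.1 N.2, max M.1 M.2), fun p hp => ?_⟩
    have a1 := hN (q.1, p.1) ⟨(le_max_left _ _).trans hq.1, (le_max_right _ _).trans hp.1⟩
    have a2 := hM (p.2, q.2) ⟨(le_max_left _ _).trans hp.2, (le_max_right _ _).trans hq.2⟩
    exact h.chain hδ a1 a2 hqR.le
  refine ⟨R + 2 * δ + dist x b, key.mono fun p hp => ?_⟩
  have := gromovProduct_le_add_dist x b (u p.1) (v p.2)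
  linarith

end Coarse

/-! ### Coarse lines -/

section Axis

variable {G : Type u} [Group G] {Y : Type w} [MetricSpace Y] [MulAction G Y] [IsIsometricSMul G Y]

/-- `g` fixes the ends of the sequences `u` and `v`. -/
def FixesEnds (u v : ℕ → Y) (g : G) : Prop :=
  GromovConverges (fun n => g • u n) u ∧ GromovConverges (fun n => g • v n) v

/-- `g` exchanges the ends of the sequences `u` and `v`. -/
def SwapsEnds (u v : ℕ → Y) (g : G) : Prop :=
  GromovConverges (fun n => g • u n) v ∧ GromovConverges (fun n => g • v n) u

theorem GromovConverges.inv_smul {x y : ℕ → Y} {g : G}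
    (h : GromovConverges (fun n => g • x n) y) : GromovConverges x (fun n => g⁻¹ • y n) := by
  simpa using h.smul g⁻¹

theorem NearAxis.smul {R : ℝ} {u v : ℕ → Y} {x : Y} (g : G)
    (h : NearAxis R (fun n => g⁻¹ • u n) (fun n => g⁻¹ • v n) x) : NearAxis R u v (g • x) := by
  refine Eventually.mono h fun p hp => ?_
  rw [← gromovProduct_smul g] at hp
  simpa using hp

theorem FourPoint.nearAxis_smul {δ R : ℝ} (h : FourPoint Y δ) (hδ : 0 ≤ δ) {u v : ℕ → Y} {x : Y}
    (hx : NearAxis R u v x) {g : G} (hg : FixesEnds u v g ∨ SwapsEnds u v g) :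
    NearAxis (R + 2 * δ) u v (g • x) := by
  refine NearAxis.smul g ?_
  rcases hg with hg | hg
  · exact h.nearAxis_of_gromovConverges hδ hx hg.1.inv_smul hg.2.inv_smul
  · exact h.nearAxis_of_gromovConverges hδ hx.swap hg.2.inv_smul hg.1.inv_smul

theorem busemann_mul_smul (u : ℕ → Y) (x : Y) (g : G) (y : Y) :
    busemann u x (g • y) = busemann u x (g • x) + busemann (fun n => g⁻¹ • u n) x y := by
  rw [← busemann_smul g (fun n => g⁻¹ • u n) x y, ← busemann_add u x (g • x) (g • y)]
  simp

theorem FourPoint.abs_busemann_smul_sub_le {δ : ℝ} (h : FourPoint Y δ) {u : ℕ → Y} {g : G}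
    (hg : GromovConverges (fun n => g • u n) u) (x y : Y) :
    |busemann u x (g • y) - busemann u x (g • x) - busemann u x y| ≤ 2 * δ := by
  rw [busemann_mul_smul, add_sub_cancel_left, abs_sub_comm]
  exact h.abs_busemann_sub_le hg.inv_smul _ _

/-- If `g` exchanges the ends, `g⁻¹ • u` represents the end of `v`, and near the axis the Busemann
functions of the two ends are almost opposite; this produces the sign change. -/
theorem FourPoint.exists_coarseLine {δ R : ℝ} (h : FourPoint Y δ) (hδ : 0 ≤ δ) {u v : ℕ → Y}
    {x : Y} (hx : NearAxis R u v x) (hG : ∀ g : G, FixesEnds u v g ∨ SwapsEnds u v g) :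
    ∃ C, 0 ≤ C ∧
      (∀ g k : G, |dist (g • x) (k • x) - (|busemann u x (g • x) - busemann u x (k • x)|)| ≤ C) ∧
      (∀ g k : G, FixesEnds u v g → |busemann u x ((g * k) • x) - busemann u x (g • x) -
        busemann u x (k • x)| ≤ C) ∧
      (∀ g k : G, SwapsEnds u v g → |busemann u x ((g * k) • x) - busemann u x (g • x) +
        busemann u x (k • x)| ≤ C) := by
  have hR := hx.nonneg
  have hx' : NearAxis (R + 2 * δ) u v x := hx.mono fun p hp => hp.trans (by linarith)
  -- Translates of `x` are only `R + 2δ` near the axis. The distance comparison adds `δ` before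
  -- doubling; the swap adds `2δ` for the change of representative.
  refine ⟨2 * (R + 3 * δ), by positivity, fun g k => ?_, fun g k hg => ?_, fun g k hg => ?_⟩
  · have := h.abs_dist_sub_busemann_le (h.nearAxis_smul hδ hx (hG g)) (h.nearAxis_smul hδ hx (hG k))
    rw [← busemann_add u x (g • x) (k • x), sub_add_cancel_left, abs_neg]
    linarith
  · rw [mul_smul]
    exact (h.abs_busemann_smul_sub_le hg.1 _ _).trans (by linarith)
  · rw [mul_smul, busemann_mul_smul]
    have h1 := h.abs_busemann_sub_le hg.2.inv_smul x (k • x)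
    have h2 := hx'.abs_busemann_add_le (h.nearAxis_smul hδ hx (hG k))
    rw [abs_le] at *
    constructor <;> linarith

end Axis

/-! ### Coarse comparison of orbits -/

section Orbits

variable {G : Type u}

/-- `D` is bounded by an affine function of `D'`. -/
def CoarselyLE (D D' : G → G → ℝ) : Prop :=
  ∃ A B : ℝ, 0 < A ∧ 0 ≤ B ∧ ∀ g h, D g h ≤ A * D' g h + B

theorem CoarselyLE.trans {D D' D'' : G → G → ℝ} (h : CoarselyLE D D') (h' : CoarselyLE D' D'') :
    CoarselyLE D D'' := by
  obtain ⟨A, B, hA, hB, h⟩ := h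
  obtain ⟨A', B', hA', hB', h'⟩ := h'
  refine ⟨A * A', A * B' + B, by positivity, by positivity, fun g k => (h g k).trans ?_⟩
  have := mul_le_mul_of_nonneg_left (h' g k) hA.le
  linarith

/-- The distance in the quasi-orbit of `x`. -/
def orbitDist {X : Type v} [MetricSpace X] (α : G → X → X) (x : X) (g h : G) : ℝ :=
  dist (α g x) (α h x)

variable [Group G]

/-- The powers of `g` stay at bounded distance from `1`. -/
def BoundedPowers (D : G → G → ℝ) (g : G) : Prop := ∃ C : ℝ, ∀ n : ℤ, D (g ^ n) 1 ≤ C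

theorem BoundedPowers.mono {D D' : G → G → ℝ} (h : CoarselyLE D D') {g : G}
    (hg : BoundedPowers D' g) : BoundedPowers D g := by
  obtain ⟨A, B, hA, -, h⟩ := h
  obtain ⟨C, hC⟩ := hg
  refine ⟨A * C + B, fun n => (h _ _).trans ?_⟩
  gcongr
  exact hC n

variable {X : Type v} [MetricSpace X] {α : G → X → X}

theorem IsQuasiAction.coarselyLE (hα : IsQuasiAction α) (x y : X) :
    CoarselyLE (orbitDist α x) (orbitDist α y) := by
  obtain ⟨K, ε, C, hK, hε, -, h⟩ := hα
  refine ⟨1, 2 * (K * dist x y + ε), one_pos, by positivity, fun g k => ?_⟩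
  have h1 := (h.quasiIsometry g).embedding.upper x y
  have h2 := (h.quasiIsometry k).embedding.upper y x
  have h3 := dist_triangle4 (α g x) (α g y) (α k y) (α k x)
  rw [dist_comm y x] at h2
  simp only [orbitDist]
  linarith

theorem IsQuasiAction.isElliptic_iff (hα : IsQuasiAction α) (x : X) (g : G) :
    IsElliptic α g ↔ BoundedPowers (orbitDist α x) g := by
  constructor
  · rintro ⟨x₀, h⟩
    refine BoundedPowers.mono (hα.coarselyLE x x₀) ?_
    obtain ⟨C, hC⟩ := Metric.isBounded_iff.1 h
    refine ⟨C, fun n => ?_⟩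
    have := hC ⟨n, rfl⟩ ⟨0, rfl⟩
    simpa [orbitDist] using this
  · rintro ⟨C, hC⟩
    refine ⟨x, (Metric.isBounded_closedBall (x := α 1 x) (r := C)).subset ?_⟩
    rintro _ ⟨n, rfl⟩
    exact hC n

theorem ReducesTo.coarselyLE {Y : Type w} [MetricSpace Y] {β : G → Y → Y} (h : ReducesTo α β)
    (hα : IsQuasiAction α) (x : X) (y : Y) :
    CoarselyLE (orbitDist α x) (orbitDist β y) ∧ CoarselyLE (orbitDist β y) (orbitDist α x) := by
  obtain ⟨F, ⟨K, ε, hF⟩, M, hM, hFM⟩ := h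
  have hK : 0 < K := one_pos.trans_le hF.one_le
  have hε := hF.nonneg
  constructor
  · refine (hα.coarselyLE x (F y)).trans ⟨K, ε + 2 * M, hK, by positivity, fun g k => ?_⟩
    have h1 := hFM g y
    have h2 := hFM k y
    have h4 := hF.upper (β g y) (β k y)
    have h5 := dist_triangle4 (α g (F y)) (F (β g y)) (F (β k y)) (α k (F y))
    rw [dist_comm (α g (F y)) (F _)] at h5
    simp only [orbitDist]
    linarith
  · refine CoarselyLE.trans ⟨K, K * (ε + 2 * M), hK, by positivity, fun g k => ?_⟩
      (hα.coarselyLE (F y) x)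
    have h1 := hFM g y
    have h2 := hFM k y
    have h4 := hF.lower (β g y) (β k y)
    have h5 := dist_triangle4 (F (β g y)) (α g (F y)) (α k (F y)) (F (β k y))
    rw [dist_comm (α k (F y))] at h5
    have h6 : (1 / K) * dist (β g y) (β k y) ≤ dist (α g (F y)) (α k (F y)) + (ε + 2 * M) := by
      linarith
    rw [one_div, inv_mul_le_iff₀ hK] at h6
    simp only [orbitDist]
    linarith

theorem ReducesTo.isElliptic_iff {Y : Type w} [MetricSpace Y] {β : G → Y → Y}
    (h : ReducesTo α β) (hα : IsQuasiAction α) (y : Y) (g : G) :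
    IsElliptic α g ↔ BoundedPowers (orbitDist β y) g := by
  obtain ⟨F, -⟩ := id h
  rw [hα.isElliptic_iff (F y)]
  have := h.coarselyLE hα (F y) y
  exact ⟨BoundedPowers.mono this.2, BoundedPowers.mono this.1⟩

end Orbits

/-! ### Quasimorphisms -/

section Quasimorphisms

variable {G : Type u} [Group G]

/-- `b` is a quasimorphism of defect at most `C`. -/
def IsQuasimorphism (C : ℝ) (b : G → ℝ) : Prop := ∀ g h, |b (g * h) - b g - b h| ≤ C

/-- The pullback of the distance of the real line. -/
def lineDist (b : G → ℝ) (g h : G) : ℝ := |b g - b h|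

theorem boundedPowers_lineDist_iff {b : G → ℝ} {g : G} :
    BoundedPowers (lineDist b) g ↔ ∃ B, ∀ n : ℤ, |b (g ^ n)| ≤ B := by
  constructor
  · rintro ⟨B, hB⟩
    refine ⟨B + |b 1|, fun n => ?_⟩
    have := abs_sub_abs_le_abs_sub (b (g ^ n)) (b 1)
    have := hB n
    simp only [lineDist] at this
    linarith
  · rintro ⟨B, hB⟩
    refine ⟨B + |b 1|, fun n => ?_⟩
    have := hB n
    exact (abs_sub _ _).trans (by linarith)

variable {C : ℝ} {b : G → ℝ}

namespace IsQuasimorphism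

theorem nonneg (hb : IsQuasimorphism C b) : 0 ≤ C := (abs_nonneg _).trans (hb 1 1)

theorem abs_one_le (hb : IsQuasimorphism C b) : |b 1| ≤ C := by
  simpa using hb 1 1

theorem abs_pow_sub_le (hb : IsQuasimorphism C b) (g : G) (n : ℕ) :
    |b (g ^ n) - n * b g| ≤ (n + 1) * C := by
  induction n with
  | zero => simpa using hb.abs_one_le
  | succ n ih =>
    have h1 := hb (g ^ n) g
    rw [← pow_succ] at h1
    push_cast
    rw [abs_le] at *
    constructor <;> linarith

/-- The powers grow at least like `n (|b g| - C)`. The point is that the resulting bound does not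
depend on `B`, hence is uniform over all such `g`. -/
theorem abs_le_of_pow_le (hb : IsQuasimorphism C b) {g : G} {B : ℝ}
    (h : ∀ n : ℕ, |b (g ^ n)| ≤ B) : |b g| ≤ C := by
  by_contra! hlt
  obtain ⟨n, hn⟩ := exists_nat_gt ((B + C) / (|b g| - C))
  rw [div_lt_iff₀ (by linarith)] at hn
  have h1 := hb.abs_pow_sub_le g n
  have h2 := h n
  have h3 : (n : ℝ) * |b g| ≤ B + (n + 1) * C := by
    have := abs_sub_abs_le_abs_sub (n * b g) (b (g ^ n))
    rw [abs_mul, Nat.abs_cast, abs_sub_comm] at this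
    linarith
  linarith

theorem le_abs_pow (hb : IsQuasimorphism C b) (g : G) (n : ℕ) :
    n * (|b g| - C) - C ≤ |b (g ^ n)| := by
  have h1 := hb.abs_pow_sub_le g n
  have := abs_sub_abs_le_abs_sub (n * b g) (b (g ^ n))
  rw [abs_mul, Nat.abs_cast, abs_sub_comm] at this
  linarith

/-- A quasimorphism that is bounded on the powers of each element of a subgroup containing all
commutators is at bounded distance from a homomorphism. -/
theorem exists_hom_of_ker (hb : IsQuasimorphism C b) (θ : G →* Multiplicative ℝ)
    (hθ : ∀ g ∈ θ.ker, ∃ B, ∀ n : ℕ, |b (g ^ n)| ≤ B) :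
    ∃ c : G →* Multiplicative ℝ, ∀ g, |b g - (c g).toAdd| ≤ 2 * C := by
  have hC := hb.nonneg
  have hker : ∀ g ∈ θ.ker, |b g| ≤ C := fun g hg => by
    obtain ⟨B, hB⟩ := hθ g hg
    exact hb.abs_le_of_pow_le hB
  have hclose : ∀ g (n : ℕ), |b (g ^ (n + 1)) / (n + 1 : ℝ) - b g| ≤ 2 * C := fun g n => by
    have h1 := hb.abs_pow_sub_le g (n + 1)
    have hn : (0 : ℝ) < n + 1 := by positivity
    have h2 : b (g ^ (n + 1)) / (n + 1 : ℝ) - b g = (b (g ^ (n + 1)) - (n + 1) * b g) / (n + 1) := by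
      field_simp
    rw [h2, abs_div, abs_of_pos hn, div_le_iff₀ hn]
    push_cast at h1
    nlinarith [mul_nonneg hC (Nat.cast_nonneg (α := ℝ) n)]
  have htend : ∀ g, Tendsto (fun n : ℕ => b (g ^ (n + 1)) / (n + 1 : ℝ))
      (hyperfilter ℕ : Filter ℕ) (𝓝 (ulim fun n : ℕ => b (g ^ (n + 1)) / (n + 1 : ℝ))) :=
    fun g => tendsto_ulim (C := 2 * C + |b g|) fun n => by
      have := abs_sub_abs_le_abs_sub (b (g ^ (n + 1)) / (n + 1 : ℝ)) (b g)
      linarith [hclose g n]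
  -- The homomorphism is the homogenization of `b`; the exponent `n + 1` avoids division by zero.
  refine ⟨MonoidHom.mk' (fun g => Multiplicative.ofAdd (ulim fun n : ℕ =>
    b (g ^ (n + 1)) / (n + 1 : ℝ))) fun g h => ?_, fun g => ?_⟩
  · rw [← ofAdd_add]
    congr 1
    have h0 : Tendsto (fun n : ℕ => 3 * C / (n + 1 : ℝ)) (hyperfilter ℕ : Filter ℕ) (𝓝 0) :=
      (tendsto_const_div_atTop_nhds_zero_nat (3 * C) |>.comp (tendsto_add_atTop_nat 1)
        |>.mono_left Nat.hyperfilter_le_atTop).congr fun n => by simp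
    have h1 := ((htend (g * h)).sub ((htend g).add (htend h)))
    refine sub_eq_zero.1 (tendsto_nhds_unique h1 (squeeze_zero_norm (fun n => ?_) h0))
    have hn : (0 : ℝ) < n + 1 := by positivity
    set m := n + 1 with hm
    -- The target of `θ` is commutative, so `(gh)^m` and `g^m h^m` differ by a kernel element, where
    -- `|b| ≤ C`. Two further defects make the error `3C`, which disappears after division by `m`.
    have hk : (g ^ m * h ^ m)⁻¹ * (g * h) ^ m ∈ θ.ker := by
      simp [MonoidHom.mem_ker, mul_pow]
    have e1 := hker _ hk
    have e2 := hb (g ^ m * h ^ m) ((g ^ m * h ^ m)⁻¹ * (g * h) ^ m)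
    have e3 := hb (g ^ m) (h ^ m)
    rw [mul_inv_cancel_left] at e2
    rw [← add_div, ← sub_div, Real.norm_eq_abs, abs_div, abs_of_pos hn]
    gcongr
    rw [abs_le] at *
    constructor <;> linarith
  · rw [abs_sub_comm]
    exact le_of_tendsto ((htend g).sub_const (b g)).abs (Eventually.of_forall (hclose g))

end IsQuasimorphism

end Quasimorphisms

/-! ### The axis of a loxodromic isometry -/

section Loxodromic

variable {G : Type u} [Group G] {Y : Type w} [MetricSpace Y] [MulAction G Y] [IsIsometricSMul G Y]

theorem GromovConverges.of_dist_le {x y z : ℕ → Y} (h : GromovConverges x y) {B : ℝ}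
    (hB : ∀ n, dist (z n) (x n) ≤ B) : GromovConverges z y := by
  intro b
  refine tendsto_atTop_mono (fun p => ?_)
    (tendsto_atTop_add_const_right atTop (-B) (h b))
  have h1 := dist_triangle_right b (x p.1) (z p.1)
  have h2 := dist_triangle (z p.1) (x p.1) (y p.2)
  have h3 := hB p.1
  rw [dist_comm (x p.1) (z p.1)] at h1
  simp only [gromovProduct]
  linarith

theorem dist_pow_smul_pow_add_smul (f : G) (z : Y) (m n : ℕ) :
    dist (f ^ m • z) (f ^ (m + n) • z) = dist z (f ^ n • z) := by
  rw [pow_add, mul_smul, dist_smul]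

theorem dist_inv_pow_smul (f : G) (z : Y) (n : ℕ) :
    dist z (f⁻¹ ^ n • z) = dist z (f ^ n • z) := by
  rw [← dist_smul (f ^ n) z, inv_pow, smul_inv_smul, dist_comm]

/-- The four-point inequality for `z, fz, f²z, f^(n+2)z` has two alternatives; the inductive
hypothesis excludes the one that would prevent growth. A margin above `2δ` would suffice here; `3δ`
is what `FourPoint.nearAxis_pow` needs. -/
theorem FourPoint.dist_pow_succ {δ : ℝ} (h : FourPoint Y δ) (hδ : 0 ≤ δ) {f : G} {z : Y}
    (hf : dist z (f • z) + 3 * δ < dist z (f ^ 2 • z)) (n : ℕ) :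
    dist z (f ^ n • z) + (dist z (f ^ 2 • z) - dist z (f • z) - 2 * δ) ≤
      dist z (f ^ (n + 1) • z) := by
  induction n with
  | zero =>
    have h1 := dist_triangle z (f • z) (f ^ 2 • z)
    have h2 := dist_pow_smul_pow_add_smul f z 1 1
    norm_num at h2 ⊢
    linarith
  | succ n ih =>
    have h1 := h.dist_add_le z (f • z) (f ^ 2 • z) (f ^ (1 + (n + 1)) • z)
    have h2 := dist_pow_smul_pow_add_smul f z 1 1
    have h3 := dist_pow_smul_pow_add_smul f z 1 (n + 1)
    have h4 := dist_pow_smul_pow_add_smul f z 2 n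
    rw [show 2 + n = 1 + (n + 1) by omega] at h4
    rw [show n + 1 + 1 = 1 + (n + 1) by omega]
    norm_num at h2 h3
    rw [h2, h3, h4] at h1
    rcases max_choice (dist z (f • z) + dist z (f ^ n • z))
      (dist z (f ^ (1 + (n + 1)) • z) + dist z (f • z)) with h5 | h5 <;> rw [h5] at h1 <;> linarith

theorem FourPoint.dist_pow_add {δ : ℝ} (h : FourPoint Y δ) (hδ : 0 ≤ δ) {f : G} {z : Y}
    (hf : dist z (f • z) + 3 * δ < dist z (f ^ 2 • z)) (m n : ℕ) :
    dist z (f ^ m • z) + n * (dist z (f ^ 2 • z) - dist z (f • z) - 2 * δ) ≤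
      dist z (f ^ (m + n) • z) := by
  induction n with
  | zero => simp
  | succ n ih =>
    have := h.dist_pow_succ hδ hf (m + n)
    rw [← add_assoc]
    push_cast
    linarith

theorem FourPoint.gromovConverges_pow {δ : ℝ} (h : FourPoint Y δ) (hδ : 0 ≤ δ) {f : G} {z : Y}
    (hf : dist z (f • z) + 3 * δ < dist z (f ^ 2 • z)) :
    GromovConverges (fun n => f ^ n • z) (fun n => f ^ n • z) := by
  set c := dist z (f ^ 2 • z) - dist z (f • z) - 2 * δ with hc
  have hc0 : 0 < c := by linarith
  have key : ∀ m n : ℕ, m * c ≤ gromovProduct z (f ^ m • z) (f ^ (m + n) • z) := fun m n => by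
    have h1 := h.dist_pow_add hδ hf 0 m
    have h2 := h.dist_pow_add hδ hf n m
    rw [zero_add, pow_zero, one_smul, dist_self] at h1
    rw [add_comm n m] at h2
    simp only [gromovProduct, dist_pow_smul_pow_add_smul]
    linarith
  have key' : ∀ m n : ℕ, (min m n : ℕ) * c ≤ gromovProduct z (f ^ m • z) (f ^ n • z) := by
    intro m n
    rcases le_total m n with h | h
    · obtain ⟨k, rfl⟩ := Nat.exists_eq_add_of_le h
      rw [min_eq_left h]
      exact key m k
    · obtain ⟨k, rfl⟩ := Nat.exists_eq_add_of_le h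
      rw [min_eq_right h, gromovProduct_comm]
      exact key n k
  intro b
  rw [tendsto_atTop]
  intro R
  obtain ⟨N, hN⟩ := exists_nat_ge ((R + dist z b) / c)
  rw [div_le_iff₀ hc0] at hN
  refine eventually_atTop.2 ⟨(N, N), fun p hp => ?_⟩
  have h1 := key' p.1 p.2
  have h2 := gromovProduct_le_add_dist z b (f ^ p.1 • z) (f ^ p.2 • z)
  have h3 : (N : ℝ) * c ≤ (min p.1 p.2 : ℕ) * c := by
    gcongr
    exact le_min hp.1 hp.2
  linarith

theorem FourPoint.nearAxis_pow {δ : ℝ} (h : FourPoint Y δ) (hδ : 0 ≤ δ) {f : G} {z : Y}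
    (hf : dist z (f • z) + 3 * δ < dist z (f ^ 2 • z)) :
    ∃ R, NearAxis R (fun n => f ^ n • z) (fun n => f⁻¹ ^ n • z) z := by
  have hf' : dist z (f⁻¹ • z) + 3 * δ < dist z (f⁻¹ ^ 2 • z) := by
    have := dist_inv_pow_smul f z 1
    rw [pow_one, pow_one] at this
    rwa [this, dist_inv_pow_smul]
  have key : ∀ f : G, dist z (f • z) + 3 * δ < dist z (f ^ 2 • z) → ∀ n : ℕ, 1 ≤ n →
      dist z (f ^ 2 • z) / 2 - δ ≤ gromovProduct z (f • z) (f ^ n • z) := by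
    intro f hf n hn
    obtain ⟨k, rfl⟩ := Nat.exists_eq_add_of_le hn
    have h1 := dist_pow_smul_pow_add_smul f z 1 k
    have h2 := h.dist_pow_succ hδ hf k
    rw [add_comm k 1] at h2
    rw [pow_one] at h1
    simp only [gromovProduct, h1]
    linarith
  have hP : gromovProduct z (f • z) (f⁻¹ • z) = dist z (f • z) - dist z (f ^ 2 • z) / 2 := by
    have h1 := dist_inv_pow_smul f z 1
    have h2 := dist_smul f (f⁻¹ • z) (f • z)
    rw [pow_one, pow_one] at h1
    rw [smul_inv_smul, smul_smul, ← pow_two, dist_comm (f⁻¹ • z)] at h2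
    simp only [gromovProduct, h1, ← h2]
    ring
  refine ⟨dist z (f • z) - dist z (f ^ 2 • z) / 2 + 2 * δ, eventually_atTop.2
    ⟨(1, 1), fun p hp => ?_⟩⟩
  have h1 := key f hf p.1 hp.1
  have h2 := key f⁻¹ hf' p.2 hp.2
  rw [dist_inv_pow_smul, gromovProduct_comm] at h2
  -- The first input of `chain` reads `d(z,fz) - d(z,f²z)/2 + 2δ < d(z,f²z)/2 - δ`, which is the
  -- hypothesis with its `3δ`.
  exact h.chain hδ (by linarith) (by linarith) hP.le

/-- A coarse action on a quasi-line in a hyperbolic space that coarsely preserves the ends has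
an axis whose ends are fixed. -/
theorem FourPoint.exists_axis {δ : ℝ} (h : FourPoint Y δ) (hδ : 0 ≤ δ) (z : Y) {C : ℝ}
    {b : G → ℝ} (hb : IsQuasimorphism C b) (hub : ∀ B, ∃ g, B < |b g|)
    (hle : CoarselyLE (orbitDist (actionMap G Y) z) (lineDist b))
    (hge : CoarselyLE (lineDist b) (orbitDist (actionMap G Y) z)) :
    ∃ (u v : ℕ → Y) (R : ℝ), GromovConverges u u ∧ NearAxis R u v z ∧
      ∀ g : G, FixesEnds u v g := by
  obtain ⟨A, B, hA, hB, hge⟩ := hge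
  obtain ⟨A', B', hA', hB', hle⟩ := hle
  have hC := hb.nonneg
  -- With `|b g| > C + A` the orbit of `⟨g⟩` moves away from `z` at speed at least `1`, up to an
  -- additive constant.
  obtain ⟨g, hg⟩ := hub (C + A)
  have hgrow : ∀ n : ℕ, n - (B + 2 * C) / A ≤ dist z (g ^ n • z) := fun n => by
    have h1 := hge (g ^ n) 1
    have h2 := hb.le_abs_pow g n
    have h3 := abs_sub_abs_le_abs_sub (b (g ^ n)) (b 1)
    have h4 := hb.abs_one_le
    have h5 : (n : ℝ) * A ≤ n * (|b g| - C) := by gcongr; linarith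
    simp only [lineDist, orbitDist, actionMap, one_smul] at h1
    rw [dist_comm] at h1
    rw [sub_le_iff_le_add, ← sub_le_iff_le_add', le_div_iff₀ hA]
    linarith
  -- If no power were visibly loxodromic, each doubling of the exponent would add at most `3δ` to
  -- the displacement, giving logarithmic instead of linear growth.
  obtain ⟨k, hk⟩ : ∃ k, dist z (g ^ k • z) + 3 * δ < dist z (g ^ (k * 2) • z) := by
    by_contra! hcon
    have h1 : ∀ j : ℕ, dist z (g ^ (2 ^ j) • z) ≤ dist z (g • z) + 3 * δ * j := fun j => by
      induction j with
      | zero => simp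
      | succ j ih =>
        have := hcon (2 ^ j)
        rw [← pow_succ] at this
        push_cast
        linarith
    set E := dist z (g • z) + (B + 2 * C) / A with hE
    have hE0 : 0 ≤ E := by positivity
    obtain ⟨i, hi⟩ := exists_nat_gt (E + 6 * δ)
    have h2 := h1 (2 * i)
    have h3 := hgrow (2 ^ (2 * i))
    have h4 : (i + 1 : ℝ) ≤ 2 ^ i := by exact_mod_cast Nat.lt_two_pow_self (n := i)
    have h5 : ((2 : ℝ) ^ i) ^ 2 = 2 ^ (2 * i) := by rw [← pow_mul, mul_comm]
    push_cast at h2 h3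
    have h7 : (0 : ℝ) ≤ i := Nat.cast_nonneg i
    nlinarith
  set f := g ^ k with hfk
  have hf : dist z (f • z) + 3 * δ < dist z (f ^ 2 • z) := by rwa [hfk, ← pow_mul]
  have hf' : dist z (f⁻¹ • z) + 3 * δ < dist z (f⁻¹ ^ 2 • z) := by
    have := dist_inv_pow_smul f z 1
    rw [pow_one, pow_one] at this
    rwa [this, dist_inv_pow_smul]
  obtain ⟨R, hR⟩ := h.nearAxis_pow hδ hf
  -- Left multiplication by `s` changes `b` by at most `|b s| + C`, so `s` moves all points of the
  -- orbit by a bounded amount and fixes both ends of the axis.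
  have key : ∀ s t : G, dist (s • t • z) (t • z) ≤ A' * (|b s| + C) + B' := fun s t => by
    have h1 := hle (s * t) t
    simp only [orbitDist, actionMap, lineDist, mul_smul] at h1
    refine h1.trans ?_
    gcongr
    have h2 := hb s t
    have h3 := abs_add_le (b (s * t) - b s - b t) (b s)
    rw [show b (s * t) - b s - b t + b s = b (s * t) - b t by ring] at h3
    linarith
  exact ⟨_, _, R, h.gromovConverges_pow hδ hf, hR, fun s =>
    ⟨(h.gromovConverges_pow hδ hf).of_dist_le fun n => key s _,
      (h.gromovConverges_pow hδ hf').of_dist_le fun n => key s _⟩⟩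

end Loxodromic

/-! ### Busemann functions in hyperbolic CAT(0) spaces -/

section CAT0

variable {Z : Type w} [MetricSpace Z]

theorem IsGeodesicFromTo.dist_left {γ : ℝ → Z} {x y : Z} (h : IsGeodesicFromTo γ x y) {s : ℝ}
    (hs : s ∈ Set.Icc 0 (dist x y)) : dist x (γ s) = s := by
  have := h.2.2 0 ⟨le_rfl, dist_nonneg⟩ s hs
  rwa [h.1, zero_sub, abs_neg, abs_of_nonneg hs.1] at this

theorem IsGeodesicFromTo.dist_right {γ : ℝ → Z} {x y : Z} (h : IsGeodesicFromTo γ x y) {s : ℝ}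
    (hs : s ∈ Set.Icc 0 (dist x y)) : dist (γ s) y = dist x y - s := by
  have := h.2.2 s hs (dist x y) ⟨dist_nonneg, le_rfl⟩
  rwa [h.2.1, abs_sub_comm, abs_of_nonneg (sub_nonneg.2 hs.2)] at this

theorem IsGeodesicFromTo.restrict {γ : ℝ → Z} {x y : Z} (h : IsGeodesicFromTo γ x y) {s : ℝ}
    (hs : s ∈ Set.Icc 0 (dist x y)) : IsGeodesicFromTo γ x (γ s) := by
  rw [IsGeodesicFromTo, h.dist_left hs]
  exact ⟨h.1, rfl, fun a ha b hb => h.2.2 a ⟨ha.1, ha.2.trans hs.2⟩ b ⟨hb.1, hb.2.trans hs.2⟩⟩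

theorem IsCAT0Space.dist_geodesics_le (hZ : IsCAT0Space Z) {γ γ' : ℝ → Z} {x y y' : Z} {R t : ℝ}
    (h : IsGeodesicFromTo γ x y) (h' : IsGeodesicFromTo γ' x y') (hR : dist x y = R)
    (hR' : dist x y' = R) (ht : t ∈ Set.Icc (0 : ℝ) 1) :
    dist (γ (t * R)) (γ' (t * R)) ≤ t * dist y y' := by
  have hR0 : 0 ≤ R := hR ▸ dist_nonneg
  have htR : t * R ∈ Set.Icc 0 (dist x y) := by
    rw [hR]
    exact ⟨mul_nonneg ht.1 hR0, mul_le_of_le_one_left hR0 ht.2⟩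
  have h1 := hZ.comparison x y' (γ (t * R)) γ' h' t ht
  have h2 := hZ.comparison x y y' γ h t ht
  rw [hR, dist_comm y' x, hR', dist_comm y' y, dist_comm y'] at h2
  rw [hR', dist_comm (γ (t * R)) x, h.dist_left htR] at h1
  refine abs_le_of_sq_le_sq' ?_ (mul_nonneg ht.1 dist_nonneg) |>.2
  have h3 := mul_le_mul_of_nonneg_left h2 ht.1
  linarith

/-- With `β = d(x,y) - d(c,y)`, the triangle inequality gives `d(c, γ s) ≥ s - β`, and comparison
gives `d(c, γ s)² ≤ (s - β)² + d(x,c)² - β²`. Factoring the difference of squares leaves an error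
independent of how far `y` is. -/
theorem IsCAT0Space.abs_busemann_approx (hZ : IsCAT0Space Z) {γ : ℝ → Z} {x y : Z} (c : Z)
    (h : IsGeodesicFromTo γ x y) {s : ℝ} (hs : dist x c < s) (hs' : s ≤ dist x y) :
    |s - dist c (γ s) - (dist x y - dist c y)| ≤ dist x c ^ 2 / (s - dist x c) := by
  have hD : 0 ≤ dist x c := dist_nonneg
  have hs0 : 0 < s := hD.trans_lt hs
  have hl : 0 < dist x y := hs0.trans_le hs'
  have hmem : s ∈ Set.Icc 0 (dist x y) := ⟨hs0.le, hs'⟩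
  set β := dist x y - dist c y with hβ
  have hβD : |β| ≤ dist x c := abs_dist_sub_le x c y
  have h1 : s - β ≤ dist c (γ s) := by
    have h2 := dist_triangle c (γ s) y
    rw [h.dist_right hmem] at h2
    linarith
  have h2 : dist c (γ s) ^ 2 ≤ dist x c ^ 2 + s ^ 2 - 2 * s * β := by
    have h3 := hZ.comparison x y c γ h (s / dist x y)
      ⟨by positivity, (div_le_one hl).2 hs'⟩
    rw [div_mul_cancel₀ _ hl.ne', dist_comm c x,
      show dist c y = dist x y - β by rw [hβ]; ring] at h3
    have h4 : s / dist x y * β ^ 2 ≤ s / dist x y * dist x c ^ 2 := by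
      have := sq_le_sq' (neg_le_of_abs_le hβD) (le_of_abs_le hβD)
      gcongr
    have h5 : (1 - s / dist x y) * dist x c ^ 2 + s / dist x y * (dist x y - β) ^ 2 -
        s / dist x y * (1 - s / dist x y) * dist x y ^ 2 =
        dist x c ^ 2 - s / dist x y * dist x c ^ 2 + s / dist x y * β ^ 2 + s ^ 2 -
          2 * s * β := by
      field_simp
      ring
    linarith
  have h3 := (abs_le.1 hβD).2
  rw [abs_sub_comm, abs_of_nonneg (by linarith), le_div_iff₀ (by linarith)]
  nlinarith [sq_nonneg β]

theorem FourPoint.dist_geodesics_le {δ : ℝ} (hδ : FourPoint Z δ) {γ γ' : ℝ → Z} {x y y' : Z}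
    {R : ℝ} (h : IsGeodesicFromTo γ x y) (h' : IsGeodesicFromTo γ' x y')
    (hR : R ∈ Set.Icc 0 (dist x y)) (hR' : R ∈ Set.Icc 0 (dist x y'))
    (hyy' : R ≤ gromovProduct x y y') : dist (γ R) (γ' R) ≤ 4 * δ := by
  have e1 : gromovProduct x (γ R) y = R := by
    simp only [gromovProduct, h.dist_left hR, h.dist_right hR]; ring
  have e2 : gromovProduct x y' (γ' R) = R := by
    rw [gromovProduct_comm]
    simp only [gromovProduct, h'.dist_left hR', h'.dist_right hR']; ring
  have e3 := hδ x (γ R) y y'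
  have e4 := hδ x (γ R) y' (γ' R)
  rw [e1, min_eq_left hyy'] at e3
  have hδ0 : 0 ≤ δ := by
    have := hδ x x x x
    simp only [min_self] at this
    linarith
  have e5 : R - δ ≤ min (gromovProduct x (γ R) y') (gromovProduct x y' (γ' R)) :=
    le_min e3 (by linarith)
  have e6 : gromovProduct x (γ R) (γ' R) = R - dist (γ R) (γ' R) / 2 := by
    simp only [gromovProduct, h.dist_left hR, h'.dist_left hR']; ring
  linarith

theorem gromovProduct_le_dist (b x y : Z) : gromovProduct b x y ≤ dist b x := by
  have := dist_triangle b x y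
  simp only [gromovProduct]; linarith

/-- Geodesics to `x n` and `y n` are `4δ`-close at time `R` by hyperbolicity, hence arbitrarily
close at a fixed time `s` once `R` is large, by CAT(0) contraction; and the position at time `s`
almost determines the Busemann difference. -/
theorem IsCAT0Space.tendsto_busemann_sub (hZ : IsCAT0Space Z) {δ : ℝ} (hδ : FourPoint Z δ)
    {x y : ℕ → Z} (hxy : GromovConverges x y) (a c : Z) :
    Tendsto (fun n => dist a (x n) - dist c (x n) - (dist a (y n) - dist c (y n))) atTop
      (𝓝 0) := by
  rw [Metric.tendsto_nhds]
  intro ε hε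
  set D := dist a c with hD
  have hD0 : 0 ≤ D := dist_nonneg
  have hδ0 : 0 ≤ δ := by
    have := hδ a a a a
    simp only [min_self] at this
    linarith
  -- This `s` makes both approximation errors at most `ε / 4`, and `R` below makes the contracted
  -- gap `(s / R) * 4δ` at most `ε / 4`.
  set s := D + 1 + 4 * D ^ 2 / ε with hs
  have hsD : D + 1 ≤ s := by
    have : 0 ≤ 4 * D ^ 2 / ε := by positivity
    linarith
  have hsε : D ^ 2 / (s - D) ≤ ε / 4 := by
    rw [div_le_iff₀ (by linarith)]
    have : ε / 4 * (s - D) = ε / 4 + D ^ 2 := by rw [hs]; field_simp; ring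
    linarith
  have hs0 : 0 < s := by linarith
  set R := s + s * (16 * δ / ε) with hR
  have hRs : s ≤ R := by
    have : 0 ≤ s * (16 * δ / ε) := by positivity
    linarith
  have hR0 : 0 < R := hs0.trans_le hRs
  have hRε : s / R * (4 * δ) ≤ ε / 4 := by
    rw [div_mul_eq_mul_div, div_le_iff₀ hR0]
    have : ε / 4 * R = ε / 4 * s + s * (4 * δ) := by rw [hR]; field_simp; ring
    have : 0 ≤ ε / 4 * s := by positivity
    linarith
  filter_upwards [(hxy.tendsto_diag a).eventually_ge_atTop R] with n hn
  obtain ⟨γ, hγ⟩ := hZ.geodesic a (x n)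
  obtain ⟨γ', hγ'⟩ := hZ.geodesic a (y n)
  have hx : R ≤ dist a (x n) := hn.trans (gromovProduct_le_dist _ _ _)
  have hy : R ≤ dist a (y n) := by
    rw [gromovProduct_comm] at hn
    exact hn.trans (gromovProduct_le_dist _ _ _)
  have b1 := hZ.abs_busemann_approx c hγ (s := s) (by linarith) (by linarith)
  have b2 := hZ.abs_busemann_approx c hγ' (s := s) (by linarith) (by linarith)
  have b3 := hδ.dist_geodesics_le hγ hγ' ⟨hR0.le, hx⟩ ⟨hR0.le, hy⟩ hn
  have b4 := hZ.dist_geodesics_le (hγ.restrict ⟨hR0.le, hx⟩) (hγ'.restrict ⟨hR0.le, hy⟩)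
    (hγ.dist_left ⟨hR0.le, hx⟩) (hγ'.dist_left ⟨hR0.le, hy⟩) (t := s / R)
    ⟨by positivity, (div_le_one hR0).2 hRs⟩
  rw [div_mul_cancel₀ _ hR0.ne'] at b4
  have b5 : s / R * dist (γ R) (γ' R) ≤ s / R * (4 * δ) := by gcongr
  have b6 := abs_dist_sub_le (γ s) (γ' s) c
  rw [dist_comm _ c, dist_comm _ c] at b6
  rw [Real.dist_eq, sub_zero, abs_lt]
  rw [abs_le] at b1 b2 b6
  constructor <;> linarith

variable {G : Type u} [Group G] [MulAction G Z] [IsIsometricSMul G Z]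

theorem IsCAT0Space.busemann_mul_smul (hZ : IsCAT0Space Z) {δ : ℝ} (hδ : FourPoint Z δ)
    {u : ℕ → Z} {g : G} (hg : GromovConverges (fun n => g • u n) u) (x y : Z) :
    busemann u x (g • y) = busemann u x (g • x) + busemann u x y := by
  rw [_root_.busemann_mul_smul]
  congr 1
  refine (sub_eq_zero.1 (tendsto_nhds_unique
    ((tendsto_busemann u x y).sub (tendsto_busemann (fun n => g⁻¹ • u n) x y)) ?_)).symm
  exact (hZ.tendsto_busemann_sub hδ hg.inv_smul x y).mono_left Nat.hyperfilter_le_atTop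

theorem IsCAT0Space.exists_hom (hZ : IsCAT0Space Z) {δ : ℝ} (hδ : FourPoint Z δ) {u : ℕ → Z}
    (hu : ∀ g : G, GromovConverges (fun n => g • u n) u) (z : Z) :
    ∃ θ : G →* Multiplicative ℝ, ∀ g, (θ g).toAdd = busemann u z (g • z) :=
  ⟨MonoidHom.mk' (fun g => Multiplicative.ofAdd (busemann u z (g • z))) fun g h => by
    rw [mul_smul, hZ.busemann_mul_smul hδ (hu g), ofAdd_add], fun _ => rfl⟩

end CAT0

/-! ### An invariant measure on the closure of an orbit -/

section InvariantMeasure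

open MeasureTheory TopologicalSpace Metric
open scoped Pointwise

variable (G : Type u) [Group G] {Z : Type w} [MetricSpace Z] [MulAction G Z]

/-- The number of balls of radius `r`, centred in the orbit of `z`, that are needed to cover the
part of `K` in the closure of this orbit. -/
noncomputable def orbitCoverNumber (z : Z) (r : ℝ) (K : Set Z) : ℕ :=
  sInf (Finset.card '' {t : Finset G | K ∩ closure (MulAction.orbit G z) ⊆
    ⋃ g ∈ t, ball (g • z) r})

variable {G}

theorem orbitCoverNumber_le {z : Z} {r : ℝ} {K : Set Z} {t : Finset G}
    (h : K ∩ closure (MulAction.orbit G z) ⊆ ⋃ g ∈ t, ball (g • z) r) :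
    orbitCoverNumber G z r K ≤ t.card :=
  Nat.sInf_le ⟨t, h, rfl⟩

theorem exists_orbit_cover (z : Z) {r : ℝ} (hr : 0 < r) {K : Set Z} (hK : IsCompact K) :
    ∃ t : Finset G, K ∩ closure (MulAction.orbit G z) ⊆ ⋃ g ∈ t, ball (g • z) r := by
  refine (hK.inter_right isClosed_closure).elim_finite_subcover (fun g : G => ball (g • z) r)
    (fun g => isOpen_ball) fun x hx => ?_
  obtain ⟨_, ⟨g, rfl⟩, hg⟩ := Metric.mem_closure_iff.1 hx.2 r hr
  exact Set.mem_iUnion.2 ⟨g, hg⟩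

theorem exists_card_eq_orbitCoverNumber (z : Z) {r : ℝ} (hr : 0 < r) {K : Set Z}
    (hK : IsCompact K) : ∃ t : Finset G,
      K ∩ closure (MulAction.orbit G z) ⊆ ⋃ g ∈ t, ball (g • z) r ∧
        t.card = orbitCoverNumber G z r K := by
  obtain ⟨t, ht⟩ := exists_orbit_cover (G := G) z hr hK
  exact Nat.sInf_mem (s := Finset.card '' {t : Finset G | K ∩ closure (MulAction.orbit G z) ⊆
    ⋃ g ∈ t, ball (g • z) r}) ⟨_, t, ht, rfl⟩

theorem orbitCoverNumber_mono (z : Z) {r : ℝ} (hr : 0 < r) {K L : Set Z} (hL : IsCompact L)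
    (h : K ⊆ L) : orbitCoverNumber G z r K ≤ orbitCoverNumber G z r L := by
  obtain ⟨t, ht, htc⟩ := exists_card_eq_orbitCoverNumber (G := G) z hr hL
  rw [← htc]
  exact orbitCoverNumber_le ((Set.inter_subset_inter_left _ h).trans ht)

theorem orbitCoverNumber_union_le (z : Z) {r : ℝ} (hr : 0 < r) {K L : Set Z} (hK : IsCompact K)
    (hL : IsCompact L) :
    orbitCoverNumber G z r (K ∪ L) ≤ orbitCoverNumber G z r K + orbitCoverNumber G z r L := by
  classical
  obtain ⟨t, ht, htc⟩ := exists_card_eq_orbitCoverNumber (G := G) z hr hK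
  obtain ⟨s, hs, hsc⟩ := exists_card_eq_orbitCoverNumber (G := G) z hr hL
  rw [← htc, ← hsc]
  refine (orbitCoverNumber_le (t := t ∪ s) ?_).trans (Finset.card_union_le _ _)
  rw [Set.union_inter_distrib_right, Finset.set_biUnion_union]
  exact Set.union_subset_union ht hs

/-- No ball of radius `r` meets both sets, so an optimal cover of the union splits. -/
theorem orbitCoverNumber_add_le (z : Z) {r : ℝ} (hr : 0 < r) {K L : Set Z} (hK : IsCompact K)
    (hL : IsCompact L) (h : ∀ x ∈ K, ∀ y ∈ L, 2 * r ≤ dist x y) :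
    orbitCoverNumber G z r K + orbitCoverNumber G z r L ≤ orbitCoverNumber G z r (K ∪ L) := by
  classical
  obtain ⟨t, ht, htc⟩ := exists_card_eq_orbitCoverNumber (G := G) z hr (hK.union hL)
  rw [← htc]
  have hsub : ∀ S : Set Z, S ⊆ K ∪ L → orbitCoverNumber G z r S ≤
      (t.filter fun g => (ball (g • z) r ∩ S).Nonempty).card := fun S hS => by
    refine orbitCoverNumber_le fun x hx => ?_
    obtain ⟨g, hg, hxg⟩ := Set.mem_iUnion₂.1 (ht ⟨hS hx.1, hx.2⟩)
    exact Set.mem_iUnion₂.2 ⟨g, Finset.mem_filter.2 ⟨hg, x, hxg, hx.1⟩, hxg⟩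
  refine (Nat.add_le_add (hsub K Set.subset_union_left) (hsub L Set.subset_union_right)).trans ?_
  rw [← Finset.card_union_of_disjoint]
  · exact Finset.card_le_card
      (Finset.union_subset (Finset.filter_subset _ _) (Finset.filter_subset _ _))
  · refine Finset.disjoint_filter.2 fun g _ => ?_
    rintro ⟨x, hx, hxK⟩ ⟨y, hy, hyL⟩
    have h1 := h x hxK y hyL
    have h2 := dist_triangle_right x y (g • z)
    rw [mem_ball] at hx hy
    linarith

theorem one_le_orbitCoverNumber {z : Z} {r : ℝ} (hr : 0 < r) {K : Set Z} (hK : IsCompact K)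
    (hz : z ∈ K) : 1 ≤ orbitCoverNumber G z r K := by
  obtain ⟨t, ht, htc⟩ := exists_card_eq_orbitCoverNumber (G := G) z hr hK
  rw [← htc, Nat.one_le_iff_ne_zero, Finset.card_ne_zero]
  obtain ⟨g, hg, -⟩ := Set.mem_iUnion₂.1 (ht ⟨hz, subset_closure (MulAction.mem_orbit_self z)⟩)
  exact ⟨g, hg⟩

variable (G) in
/-- The covering number of `K` at scale `1 / (n + 1)`, relative to that of the unit ball. -/
noncomputable def coverRatio (z : Z) (K : Set Z) (n : ℕ) : ℝ :=
  orbitCoverNumber G z (1 / (n + 1)) K / orbitCoverNumber G z (1 / (n + 1)) (closedBall z 1)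

theorem coverRatio_nonneg (z : Z) (K : Set Z) (n : ℕ) : 0 ≤ coverRatio G z K n := by
  unfold coverRatio; positivity

theorem orbitCoverNumber_closedBall_pos [ProperSpace Z] (z : Z) (n : ℕ) :
    (0 : ℝ) < orbitCoverNumber G z (1 / (n + 1)) (closedBall z 1) := by
  have := one_le_orbitCoverNumber (G := G) (r := 1 / ((n : ℝ) + 1)) (by positivity)
    (isCompact_closedBall z 1) (mem_closedBall_self zero_le_one)
  exact_mod_cast this

variable [IsIsometricSMul G Z]

theorem smul_mem_closure_orbit {z x : Z} (g : G) (hx : x ∈ closure (MulAction.orbit G z)) :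
    g • x ∈ closure (MulAction.orbit G z) := by
  refine map_mem_closure (continuous_const_smul g) hx ?_
  rintro _ ⟨k, rfl⟩
  exact ⟨g * k, mul_smul g k z⟩

theorem orbitCoverNumber_smul_le (z : Z) {r : ℝ} (hr : 0 < r) {K : Set Z} (hK : IsCompact K)
    (g : G) : orbitCoverNumber G z r ((g • ·) '' K) ≤ orbitCoverNumber G z r K := by
  classical
  obtain ⟨t, ht, htc⟩ := exists_card_eq_orbitCoverNumber (G := G) z hr hK
  rw [← htc]
  refine (orbitCoverNumber_le (t := t.image (g * ·)) ?_).trans Finset.card_image_le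
  rintro _ ⟨⟨x, hx, rfl⟩, hgx⟩
  have hx' : x ∈ closure (MulAction.orbit G z) := by
    simpa using smul_mem_closure_orbit g⁻¹ hgx
  obtain ⟨k, hk, hxk⟩ := Set.mem_iUnion₂.1 (ht ⟨hx, hx'⟩)
  refine Set.mem_iUnion₂.2 ⟨g * k, Finset.mem_image_of_mem _ hk, ?_⟩
  simpa [mul_smul] using hxk

theorem orbitCoverNumber_smul (z : Z) {r : ℝ} (hr : 0 < r) {K : Set Z} (hK : IsCompact K)
    (g : G) : orbitCoverNumber G z r ((g • ·) '' K) = orbitCoverNumber G z r K := by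
  refine (orbitCoverNumber_smul_le z hr hK g).antisymm ?_
  have := orbitCoverNumber_smul_le z hr (hK.image (continuous_const_smul g)) g⁻¹
  simpa [Set.image_image] using this

/-- Each unit ball around an orbit point is translated back to `z` and covered there. As `t` does
not depend on `r`, covering ratios stay bounded at all scales. -/
theorem orbitCoverNumber_le_mul {z : Z} {r : ℝ} (hr : 0 < r) {K B : Set Z} (hB : IsCompact B)
    (hzB : ball z 1 ⊆ B) {t : Finset G}
    (ht : K ∩ closure (MulAction.orbit G z) ⊆ ⋃ g ∈ t, ball (g • z) 1) :
    orbitCoverNumber G z r K ≤ t.card * orbitCoverNumber G z r B := by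
  classical
  obtain ⟨s, hs, hsc⟩ := exists_card_eq_orbitCoverNumber (G := G) z hr hB
  rw [← hsc, ← Finset.card_product]
  refine (orbitCoverNumber_le (t := (t ×ˢ s).image fun p => p.1 * p.2) ?_).trans
    Finset.card_image_le
  intro x hx
  obtain ⟨g, hg, hxg⟩ := Set.mem_iUnion₂.1 (ht hx)
  have h1 : g⁻¹ • x ∈ B := hzB (by
    rw [mem_ball, ← dist_smul g]
    simpa using hxg)
  obtain ⟨k, hk, hxk⟩ := Set.mem_iUnion₂.1 (hs ⟨h1, smul_mem_closure_orbit g⁻¹ hx.2⟩)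
  refine Set.mem_iUnion₂.2 ⟨g * k, Finset.mem_image.2 ⟨(g, k), Finset.mk_mem_product hg hk, rfl⟩, ?_⟩
  rw [mem_ball, ← dist_smul g] at hxk
  simpa [mul_smul] using hxk

variable [ProperSpace Z]

theorem tendsto_coverRatio (z : Z) {K : Set Z} (hK : IsCompact K) :
    Tendsto (coverRatio G z K) (hyperfilter ℕ : Filter ℕ) (𝓝 (ulim (coverRatio G z K))) := by
  obtain ⟨t, ht⟩ := exists_orbit_cover (G := G) z one_pos hK
  refine tendsto_ulim (C := t.card) fun n => ?_
  rw [abs_of_nonneg (coverRatio_nonneg z K n), coverRatio,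
    div_le_iff₀ (orbitCoverNumber_closedBall_pos z n)]
  exact_mod_cast orbitCoverNumber_le_mul (by positivity) (isCompact_closedBall z 1)
    ball_subset_closedBall ht

theorem ulim_coverRatio_nonneg (z : Z) {K : Set Z} (hK : IsCompact K) :
    0 ≤ ulim (coverRatio G z K) :=
  ge_of_tendsto' (tendsto_coverRatio z hK) (coverRatio_nonneg z K)

variable (G) in
/-- The invariant content defined by the covering numbers of an orbit. -/
noncomputable def orbitContent (z : Z) : Content Z where
  toFun K := (ulim (coverRatio G z K)).toNNReal
  mono' K L h := by
    refine Real.toNNReal_le_toNNReal (le_of_tendsto_of_tendsto' (tendsto_coverRatio z K.isCompact)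
      (tendsto_coverRatio z L.isCompact) fun n => ?_)
    unfold coverRatio
    gcongr
    exact orbitCoverNumber_mono z (by positivity) L.isCompact h
  sup_disjoint' K L h hK hL := by
    rw [← Real.toNNReal_add (ulim_coverRatio_nonneg z K.isCompact)
      (ulim_coverRatio_nonneg z L.isCompact)]
    congr 1
    refine tendsto_nhds_unique (tendsto_coverRatio z (K ⊔ L).isCompact)
      (((tendsto_coverRatio z K.isCompact).add (tendsto_coverRatio z L.isCompact)).congr' ?_)
    -- Disjoint compact sets are a positive distance apart, so their covering numbers add at all
    -- sufficiently fine scales.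
    obtain ⟨r, hr, hKL⟩ : ∃ r, 0 < r ∧ ∀ x ∈ K, ∀ y ∈ L, r ≤ dist x y := by
      obtain ⟨r, hr, h⟩ := K.isCompact.exists_thickening_subset_open hL.isOpen_compl
        (Set.subset_compl_iff_disjoint_right.2 h)
      refine ⟨r, hr, fun x hx y hy => ?_⟩
      by_contra! hlt
      exact h (mem_thickening_iff.2 ⟨x, hx, by rwa [dist_comm]⟩) hy
    obtain ⟨N, hN⟩ := exists_nat_gt (2 / r)
    rw [div_lt_iff₀ hr] at hN
    refine ((eventually_ge_atTop N).mono fun n hn => ?_).hyperfilter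
    simp only [coverRatio]
    rw [← add_div]
    congr 1
    norm_cast
    have hn' : (N : ℝ) ≤ n := by exact_mod_cast hn
    have hpos : (0 : ℝ) < 1 / ((n : ℝ) + 1) := by positivity
    have hle : 2 * (1 / ((n : ℝ) + 1)) ≤ r := by
      rw [mul_one_div, div_le_iff₀ (by positivity)]
      nlinarith
    have e1 := orbitCoverNumber_add_le (G := G) z hpos K.isCompact L.isCompact
      fun x hx y hy => hle.trans (hKL x hx y hy)
    have e2 := orbitCoverNumber_union_le (G := G) z hpos K.isCompact L.isCompact
    rw [Compacts.coe_sup]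
    push_cast
    exact e1.antisymm e2
  sup_le' K L := by
    rw [← Real.toNNReal_add (ulim_coverRatio_nonneg z K.isCompact)
      (ulim_coverRatio_nonneg z L.isCompact)]
    refine Real.toNNReal_le_toNNReal (le_of_tendsto_of_tendsto'
      (tendsto_coverRatio z (K ⊔ L).isCompact)
      ((tendsto_coverRatio z K.isCompact).add (tendsto_coverRatio z L.isCompact)) fun n => ?_)
    simp only [coverRatio]
    rw [← add_div]
    gcongr
    exact_mod_cast orbitCoverNumber_union_le (G := G) z (by positivity) K.isCompact L.isCompact

theorem orbitContent_apply (z : Z) (K : Compacts Z) :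
    orbitContent G z K = (ulim (coverRatio G z K)).toNNReal := rfl

theorem orbitContent_map (z : Z) (g : G) (K : Compacts Z) :
    orbitContent G z (K.map (Homeomorph.smul g) (Homeomorph.smul g).continuous) =
      orbitContent G z K := by
  rw [orbitContent_apply, orbitContent_apply]
  congr 3
  funext n
  simp only [coverRatio, Compacts.coe_map]
  congr 2
  exact orbitCoverNumber_smul z (by positivity) K.isCompact g

variable (G) in
-- Centring the covering balls in the orbit makes the content invariant and concentrates it on the
-- closure of the orbit, even when the action is not cocompact on the whole space.
theorem exists_invariant_measure (z : Z) [MeasurableSpace Z] [BorelSpace Z] :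
    ∃ μ : Measure Z, (∀ g : G, MeasurePreserving (g • ·) μ μ) ∧
      (∀ K, IsCompact K → μ K < ⊤) ∧ μ (closure (MulAction.orbit G z))ᶜ = 0 ∧
      1 ≤ μ (closedBall z 1) := by
  refine ⟨(orbitContent G z).measure, fun g => ⟨(measurable_const_smul g), ?_⟩, fun K hK => ?_,
    ?_, ?_⟩
  · ext s hs
    rw [Measure.map_apply (measurable_const_smul g) hs, Content.measure_apply _ hs,
      Content.measure_apply _ (measurable_const_smul g hs)]
    exact (orbitContent G z).outerMeasure_preimage (Homeomorph.smul g)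
      (fun K => orbitContent_map z g K) s
  · rw [Content.measure_apply _ hK.measurableSet]
    exact Content.outerMeasure_lt_top_of_isCompact _ hK
  · rw [Content.measure_apply _ isClosed_closure.measurableSet.compl,
      Content.outerMeasure_of_isOpen _ _ isClosed_closure.isOpen_compl, Content.innerContent]
    simp only [ENNReal.iSup_eq_zero]
    intro K hK
    rw [orbitContent_apply]
    have h0 : coverRatio G z K = fun _ => 0 := by
      funext n
      have : orbitCoverNumber G z (1 / ((n : ℝ) + 1)) K ≤ (∅ : Finset G).card :=
        orbitCoverNumber_le fun x hx => (hK hx.1 hx.2).elim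
      simp only [Finset.card_empty, nonpos_iff_eq_zero] at this
      rw [coverRatio, this, Nat.cast_zero, zero_div]
    have h1 := tendsto_coverRatio (G := G) z K.isCompact
    rw [h0] at h1
    rw [h0, tendsto_nhds_unique h1 tendsto_const_nhds]
    simp
  · rw [Content.measure_apply _ isClosed_closedBall.measurableSet]
    refine le_trans ?_ ((orbitContent G z).le_outerMeasure_compacts
      ⟨closedBall z 1, isCompact_closedBall z 1⟩)
    rw [orbitContent_apply]
    have h0 : coverRatio G z (closedBall z 1) = fun _ => 1 := by
      funext n
      exact div_self (orbitCoverNumber_closedBall_pos z n).ne'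
    have h1 := tendsto_coverRatio (G := G) z (isCompact_closedBall z 1)
    rw [h0] at h1
    simp only [Compacts.coe_mk]
    rw [h0, tendsto_nhds_unique h1 tendsto_const_nhds]
    simp

end InvariantMeasure

/-! ### The flux homomorphism -/

section Flux

open MeasureTheory Metric

variable {G : Type u} [Group G] {Z : Type w} [MetricSpace Z] [MulAction G Z] [IsIsometricSMul G Z]

/-- A coarse height function on a proper space, along which an orbit is a quasi-line, gives a
homomorphism that vanishes exactly on the elements whose powers have bounded height. -/
theorem exists_hom_of_height [ProperSpace Z] {z : Z} {β : Z → ℝ} {C : ℝ}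
    (hβz : β z = 0) (hlip : ∀ x y, |β x - β y| ≤ dist x y)
    (hβ : ∀ (g : G) (x : Z), |β (g • x) - β (g • z) - β x| ≤ C)
    (hline : ∀ g : G, dist (g • z) z ≤ |β (g • z)| + C) (hub : ∀ B, ∃ g : G, B < |β (g • z)|) :
    ∃ θ : G →* Multiplicative ℝ,
      ∀ g, g ∈ θ.ker ↔ ∃ B, ∀ n : ℤ, |β (g ^ n • z)| ≤ B := by
  borelize Z
  have hC : 0 ≤ C := (abs_nonneg _).trans (hβ 1 z)
  have hcont : Continuous β := (LipschitzWith.of_dist_le_mul (K := 1) fun x y => by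
    simpa [Real.dist_eq] using hlip x y).continuous
  obtain ⟨μ, hinv, hfin, hO, hpos⟩ := exists_invariant_measure G z
  set O := closure (MulAction.orbit G z) with hOdef
  have hOdist : ∀ x ∈ O, dist x z ≤ |β x| + C := by
    have : IsClosed {x : Z | dist x z ≤ |β x| + C} :=
      isClosed_le (by fun_prop) (by fun_prop)
    refine fun x hx => closure_minimal ?_ this hx
    rintro _ ⟨g, rfl⟩
    exact hline g
  -- On the closure of the orbit, height controls distance to `z`, so these slabs are compact and
  -- have finite measure.
  set S : ℝ → Set Z := fun T => O ∩ {x | |β x| ≤ T} with hS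
  have hSmem : ∀ T x, x ∈ O → |β x| ≤ T → x ∈ S T := fun T x h h' => ⟨h, h'⟩
  have hScomp : ∀ T, IsCompact (S T) := fun T => by
    refine isCompact_of_isClosed_isBounded
      (isClosed_closure.inter (isClosed_le (by fun_prop) (by fun_prop))) ?_
    refine (isBounded_closedBall (x := z) (r := T + C)).subset fun x hx => ?_
    have h1 := hOdist x hx.1
    have h2 : |β x| ≤ T := hx.2
    rw [mem_closedBall]
    linarith
  set F : Z → ℝ := {x | β x ≤ 0}.indicator 1 with hF
  have hFmeas : Measurable F :=
    measurable_one.indicator (isClosed_le hcont continuous_const).measurableSet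
  have hF1 : ∀ x, β x ≤ 0 → F x = 1 := fun x hx => Set.indicator_of_mem (s := {x | β x ≤ 0}) hx 1
  have hF0 : ∀ x, 0 < β x → F x = 0 := fun x hx =>
    Set.indicator_of_notMem (s := {x | β x ≤ 0}) (not_le.2 hx) 1
  -- The integral of `H g` is the net measure that `g` carries across height `0`. The half-space may
  -- have infinite measure, but almost everywhere `H g` is supported in a slab.
  set H : G → Z → ℝ := fun g x => F (g⁻¹ • x) - F x with hH
  have hHmeas : ∀ g, Measurable (H g) := fun g =>
    (hFmeas.comp (measurable_const_smul g⁻¹)).sub hFmeas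
  have hbound : ∀ g, ∀ᵐ x ∂μ, ‖H g x‖ ≤ (S (|β (g⁻¹ • z)| + C)).indicator 1 x := fun g => by
    filter_upwards [compl_mem_ae_iff.2 hO] with x hx
    have hx : x ∈ O := by simpa using hx
    have h1 := hβ g⁻¹ x
    have h2 := neg_abs_le (β (g⁻¹ • z))
    have h3 := le_abs_self (β (g⁻¹ • z))
    have hind : 0 ≤ (S (|β (g⁻¹ • z)| + C)).indicator (1 : Z → ℝ) x :=
      Set.indicator_nonneg (fun _ _ => zero_le_one) x
    rw [abs_le] at h1
    rcases le_or_gt (β x) 0 with h4 | h4 <;> rcases le_or_gt (β (g⁻¹ • x)) 0 with h5 | h5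
    · simpa [hH, hF1 _ h4, hF1 _ h5] using hind
    · have : x ∈ S (|β (g⁻¹ • z)| + C) :=
        hSmem _ _ hx (abs_le.2 ⟨by linarith, by linarith⟩)
      simp [hH, hF1 _ h4, hF0 _ h5, Set.indicator_of_mem this]
    · have : x ∈ S (|β (g⁻¹ • z)| + C) :=
        hSmem _ _ hx (abs_le.2 ⟨by linarith, by linarith⟩)
      simp [hH, hF0 _ h4, hF1 _ h5, Set.indicator_of_mem this]
    · simpa [hH, hF0 _ h4, hF0 _ h5] using hind
  have hSint : ∀ T, Integrable ((S T).indicator (1 : Z → ℝ)) μ := fun T =>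
    (integrable_indicator_iff (hScomp T).measurableSet).2
      (integrableOn_const (hfin _ (hScomp T)).ne)
  have hHint : ∀ g, Integrable (H g) μ := fun g =>
    (hSint _).mono' (hHmeas g).aestronglyMeasurable (hbound g)
  have hadd : ∀ g k, ∫ x, H (g * k) x ∂μ = ∫ x, H g x ∂μ + ∫ x, H k x ∂μ := fun g k => by
    have h1 : ∀ x, H (g * k) x = H g x + H k (g⁻¹ • x) := fun x => by
      simp only [hH, mul_inv_rev, mul_smul]
      ring
    have h2 : ∫ x, H k (g⁻¹ • x) ∂μ = ∫ x, H k x ∂μ :=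
      (hinv g⁻¹).integral_comp (Homeomorph.smul g⁻¹).measurableEmbedding (H k)
    have h3 : Integrable (fun x => H k (g⁻¹ • x)) μ :=
      (hinv g⁻¹).integrable_comp_of_integrable (hHint k)
    simp_rw [h1]
    rw [integral_add (hHint g) h3, h2]
  refine ⟨MonoidHom.mk' (fun g => Multiplicative.ofAdd (∫ x, H g x ∂μ)) fun g k => by
    rw [hadd, ofAdd_add], fun g => ?_⟩
  set θ : G →* Multiplicative ℝ := MonoidHom.mk' (fun g => Multiplicative.ofAdd (∫ x, H g x ∂μ))
    fun g k => by rw [hadd, ofAdd_add] with hθ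
  have hθg : ∀ g, (θ g).toAdd = ∫ x, H g x ∂μ := fun g => rfl
  constructor
  · intro hg
    by_contra! hcon
    have hinvβ : ∀ g : G, |β (g⁻¹ • z) + β (g • z)| ≤ C := fun g => by
      have := hβ g (g⁻¹ • z)
      rw [smul_inv_smul, hβz, zero_sub, ← neg_add', abs_neg, add_comm] at this
      exact this
    -- Height above `1` at `k • z` keeps the unit ball around it, of measure at least `1`, at
    -- positive height.
    obtain ⟨k, hk⟩ : ∃ k : G, 1 < β (k • z) := by
      obtain ⟨k, hk⟩ := hub (1 + C)
      have := abs_le.1 (hinvβ k)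
      rcases lt_abs.1 hk with h | h
      · exact ⟨k, by linarith⟩
      · exact ⟨k⁻¹, by linarith⟩
    -- Such an `s⁻¹` lowers every point, so `H s ≥ 0`, and brings that whole ball below height `0`,
    -- so the flux is positive.
    have hpositive : ∀ s : G, β (s⁻¹ • z) ≤ -(β (k • z) + 1 + C) → 0 < ∫ x, H s x ∂μ := by
      intro s hs
      have hle : ∀ x, β (s⁻¹ • x) ≤ β x - (β (k • z) + 1) := fun x => by
        have := abs_le.1 (hβ s⁻¹ x)
        linarith
      have hB : IsCompact (closedBall (k • z) 1) := isCompact_closedBall _ _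
      have hBμ : 1 ≤ μ (closedBall (k • z) 1) := by
        rw [← (hinv k).measure_preimage hB.measurableSet.nullMeasurableSet]
        refine hpos.trans (measure_mono fun x hx => ?_)
        simpa using hx
      have h1 : ∫ x, (closedBall (k • z) 1).indicator (1 : Z → ℝ) x ∂μ ≤ ∫ x, H s x ∂μ := by
        refine integral_mono ((integrable_indicator_iff hB.measurableSet).2
          (integrableOn_const (hfin _ hB).ne)) (hHint s) fun x => ?_
        by_cases hx : x ∈ closedBall (k • z) 1
        · have h2 := abs_le.1 (hlip x (k • z))
          have h3 := mem_closedBall.1 hx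
          have h4 := hle x
          rw [Set.indicator_of_mem hx]
          simp [hH, hF1 (s⁻¹ • x) (by linarith), hF0 x (by linarith)]
        · rw [Set.indicator_of_notMem hx]
          have h4 := hle x
          rcases le_or_gt (β x) 0 with h5 | h5
          · simp [hH, hF1 _ h5, hF1 (s⁻¹ • x) (by linarith)]
          · simp only [hH, hF0 _ h5, sub_zero]
            exact Set.indicator_nonneg (fun _ _ => zero_le_one) _
      rw [integral_indicator_one hB.measurableSet] at h1
      refine lt_of_lt_of_le ?_ h1
      exact ENNReal.toReal_pos (one_pos.trans_le hBμ).ne' (hfin _ hB).ne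
    obtain ⟨n, hn⟩ := hcon (β (k • z) + 1 + C + C)
    have hker : ∀ m : ℤ, ∫ x, H (g ^ m) x ∂μ = 0 := fun m => by
      have h : g ^ m ∈ θ.ker := θ.ker.zpow_mem hg m
      rw [← hθg, MonoidHom.mem_ker.1 h, toAdd_one]
    have h1 := abs_le.1 (hinvβ (g ^ n))
    rcases lt_abs.1 hn with h | h
    · exact (hpositive (g ^ n) (by linarith)).ne' (hker n)
    · have h2 := hpositive (g ^ (-n)) (by rw [zpow_neg, inv_inv]; linarith)
      exact h2.ne' (hker _)
  · rintro ⟨B, hB⟩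
    -- All powers of `g` have flux bounded by the measure of one fixed slab, while the flux of `g ^
    -- n` is `n` times that of `g`.
    have h1 : ∀ n : ℕ, |n * (θ g).toAdd| ≤ ∫ x, (S (B + C)).indicator (1 : Z → ℝ) x ∂μ := by
      intro n
      have h2 : (n : ℝ) * (θ g).toAdd = ∫ x, H (g ^ n) x ∂μ := by
        rw [← hθg, map_pow, toAdd_pow, nsmul_eq_mul]
      rw [h2, ← Real.norm_eq_abs]
      refine norm_integral_le_of_norm_le (hSint _) ?_
      filter_upwards [hbound (g ^ n)] with x hx
      have h3 := hB (-n)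
      rw [zpow_neg, zpow_natCast] at h3
      have hsub : S (|β ((g ^ n)⁻¹ • z)| + C) ⊆ S (B + C) := fun y hy =>
        hSmem _ _ hy.1 (le_trans hy.2 (by linarith))
      exact hx.trans (Set.indicator_le_indicator_of_subset hsub (fun _ => zero_le_one) x)
    rw [MonoidHom.mem_ker]
    by_contra hne
    have hne' : 0 < |(θ g).toAdd| := abs_pos.2 fun h => hne (toAdd_eq_zero.1 h)
    obtain ⟨n, hn⟩ := exists_nat_gt ((∫ x, (S (B + C)).indicator (1 : Z → ℝ) x ∂μ) /
      |(θ g).toAdd|)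
    rw [div_lt_iff₀ hne'] at hn
    have := h1 n
    rw [abs_mul, Nat.abs_cast] at this
    linarith

end Flux

/-! ### Quasi-lines in proper or CAT(0) hyperbolic spaces -/

section Rigidity

variable {G : Type u}

theorem coarselyLE_of_abs_sub_le {D D' : G → G → ℝ} {C : ℝ} (hC : 0 ≤ C)
    (h : ∀ g k, |D g k - D' g k| ≤ C) : CoarselyLE D D' ∧ CoarselyLE D' D := by
  refine ⟨⟨1, C, one_pos, hC, fun g k => ?_⟩, ⟨1, C, one_pos, hC, fun g k => ?_⟩⟩ <;>
  · have := abs_le.1 (h g k)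
    linarith

variable [Group G]

theorem isQuasimorphism_toAdd (θ : G →* Multiplicative ℝ) :
    IsQuasimorphism 0 fun g => (θ g).toAdd := fun g h => by simp

theorem mem_ker_iff_bounded (θ : G →* Multiplicative ℝ) (g : G) :
    g ∈ θ.ker ↔ ∃ B, ∀ n : ℤ, |(θ (g ^ n)).toAdd| ≤ B := by
  constructor
  · intro hg
    refine ⟨0, fun n => ?_⟩
    rw [MonoidHom.mem_ker.1 (θ.ker.zpow_mem hg n)]
    simp
  · rintro ⟨B, hB⟩
    have := (isQuasimorphism_toAdd θ).abs_le_of_pow_le (g := g) (B := B) fun n => by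
      simpa using hB n
    exact MonoidHom.mem_ker.2 (toAdd_eq_zero.1 (abs_eq_zero.1 (this.antisymm (abs_nonneg _))))

/-- If a hyperbolic space is proper or CAT(0), and an isometric action on it has an orbit that is
a quasi-line along which the group acts by a quasimorphism, then the elliptic elements form the
kernel of a homomorphism to the real numbers. -/
theorem exists_hom_of_coarselyLE {Z : Type t} [MetricSpace Z] [IsHyperbolicSpace Z]
    [MulAction G Z] [IsIsometricSMul G Z] (hZ : ProperSpace Z ∨ IsCAT0Space Z) (z : Z) {C : ℝ}
    {b : G → ℝ} (hb : IsQuasimorphism C b) (hub : ∀ B, ∃ g, B < |b g|)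
    (hle : CoarselyLE (orbitDist (actionMap G Z) z) (lineDist b))
    (hge : CoarselyLE (lineDist b) (orbitDist (actionMap G Z) z)) :
    ∃ θ : G →* Multiplicative ℝ,
      ∀ g, g ∈ θ.ker ↔ BoundedPowers (orbitDist (actionMap G Z) z) g := by
  obtain ⟨δ, hδ, h⟩ := IsHyperbolicSpace.hyperbolic (X := Z)
  have h : FourPoint Z δ := h
  obtain ⟨u, v, R, -, hR, hfix⟩ := h.exists_axis hδ z hb hub hle hge
  obtain ⟨C', hC', hline, -, -⟩ := h.exists_coarseLine hδ hR fun g => Or.inl (hfix g)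
  have hβz : busemann u z z = 0 := by
    have := abs_busemann_le u z z
    rw [dist_self] at this
    exact abs_eq_zero.1 (this.antisymm (abs_nonneg _))
  have hcmp := coarselyLE_of_abs_sub_le (D := orbitDist (actionMap G Z) z)
    (D' := lineDist fun g => busemann u z (g • z)) hC' hline
  have hpow : ∀ g, BoundedPowers (orbitDist (actionMap G Z) z) g ↔
      ∃ B, ∀ n : ℤ, |busemann u z (g ^ n • z)| ≤ B := fun g =>
    Iff.trans ⟨BoundedPowers.mono hcmp.2, BoundedPowers.mono hcmp.1⟩ boundedPowers_lineDist_iff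
  simp_rw [hpow]
  rcases hZ with hZ | hZ
  · have hsub : ∀ x y, busemann u z x - busemann u z y = busemann u y x := fun x y => by
      rw [← busemann_add u z y x, add_sub_cancel_left]
    refine exists_hom_of_height (C := C' + 2 * δ) hβz (fun x y => ?_) (fun g x => ?_)
      (fun g => ?_) fun B => ?_
    · rw [hsub, dist_comm]
      exact abs_busemann_le u y x
    · exact (h.abs_busemann_smul_sub_le (hfix g).1 z x).trans (by linarith)
    · have := abs_le.1 (hline g 1)
      rw [one_smul, hβz, sub_zero] at this
      linarith
    · obtain ⟨A, B', hA, hB', hD⟩ := hge.trans hcmp.1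
      obtain ⟨g, hg⟩ := hub (A * B + B' + |b 1|)
      refine ⟨g, ?_⟩
      have h1 := hD g 1
      simp only [lineDist, one_smul, hβz, sub_zero] at h1
      have h2 := abs_sub_abs_le_abs_sub (b g) (b 1)
      exact lt_of_mul_lt_mul_left (by linarith) hA.le
  · obtain ⟨θ, hθ⟩ := hZ.exists_hom h (fun g => (hfix g).1) z
    refine ⟨θ, fun g => ?_⟩
    rw [mem_ker_iff_bounded]
    simp_rw [hθ]

end Rigidity

/-! ### Lineal actions -/

section Lineal

variable {G : Type u} [Group G] {Y : Type w} [MetricSpace Y] [IsHyperbolicSpace Y] [MulAction G Y]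
  [IsIsometricSMul G Y]

theorem boundaryPoint_eq_iff (s s' : SeqToInfinity Y) :
    boundaryPoint s = boundaryPoint s' ↔ GromovConverges s.1 s'.1 :=
  Quotient.eq (r := boundarySetoid Y)

theorem boundaryMap_boundaryPoint (g : G) (s : SeqToInfinity Y) :
    boundaryMap g (boundaryPoint s) = boundaryPoint ⟨fun n => g • s.1 n, s.2.smul g⟩ := rfl

theorem boundaryMap_boundaryPoint_eq_iff (g : G) (s s' : SeqToInfinity Y) :
    boundaryMap g (boundaryPoint s) = boundaryPoint s' ↔
      GromovConverges (fun n => g • s.1 n) s'.1 := by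
  rw [boundaryMap_boundaryPoint, boundaryPoint_eq_iff]

theorem boundaryPoint_surjective (ζ : GromovBoundary Y) : ∃ s, boundaryPoint s = ζ :=
  Quotient.exists_rep ζ

theorem boundaryMap_one (ζ : GromovBoundary Y) : boundaryMap (1 : G) ζ = ζ := by
  obtain ⟨s, rfl⟩ := boundaryPoint_surjective ζ
  simp [boundaryMap_boundaryPoint]

theorem boundaryMap_mul (g k : G) (ζ : GromovBoundary Y) :
    boundaryMap (g * k) ζ = boundaryMap g (boundaryMap k ζ) := by
  obtain ⟨s, rfl⟩ := boundaryPoint_surjective ζ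
  simp [boundaryMap_boundaryPoint, mul_smul]

theorem boundaryMap_injective (g : G) : Function.Injective (boundaryMap (X := Y) g) :=
  Function.LeftInverse.injective (g := boundaryMap g⁻¹) fun ζ => by
    rw [← boundaryMap_mul, inv_mul_cancel, boundaryMap_one]

theorem boundaryMap_mem_limitSet (g : G) {ζ : GromovBoundary Y} (hζ : ζ ∈ limitSet G Y) :
    boundaryMap g ζ ∈ limitSet G Y := by
  obtain ⟨x, s, hs, rfl⟩ := hζ
  refine ⟨x, ⟨fun n => g • s.1 n, s.2.smul g⟩, fun n => ?_, rfl⟩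
  obtain ⟨k, hk⟩ := hs n
  exact ⟨g * k, by simp only [mul_smul, ← hk]⟩

variable (G Y) in
/-- The subgroup of the elements that fix each point of the limit set. -/
def limitFixer : Subgroup G where
  carrier := {g | ∀ ζ ∈ limitSet G Y, boundaryMap g ζ = ζ}
  one_mem' ζ _ := boundaryMap_one ζ
  mul_mem' hg hk ζ hζ := by rw [boundaryMap_mul, hk ζ hζ, hg ζ hζ]
  inv_mem' {g} hg ζ hζ := boundaryMap_injective g (by
    rw [← boundaryMap_mul, mul_inv_cancel, boundaryMap_one, hg ζ hζ])

theorem boundaryMap_swap_of_notMem {ξ η : GromovBoundary Y} (hL : limitSet G Y = {ξ, η})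
    {g : G} (hg : g ∉ limitFixer G Y) : boundaryMap g ξ = η ∧ boundaryMap g η = ξ := by
  have h1 : boundaryMap g ξ ∈ ({ξ, η} : Set _) :=
    hL ▸ boundaryMap_mem_limitSet g (by rw [hL]; simp)
  have h2 : boundaryMap g η ∈ ({ξ, η} : Set _) :=
    hL ▸ boundaryMap_mem_limitSet g (by rw [hL]; simp)
  have hne : ξ = η → boundaryMap g ξ = ξ → g ∈ limitFixer G Y := by
    rintro rfl h ζ hζ
    rw [hL] at hζ
    rcases hζ with rfl | rfl <;> exact h
  rcases h1 with h1 | h1 <;> rcases h2 with h2 | h2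
  · exact absurd (hne (boundaryMap_injective g (h1.trans h2.symm)) h1) hg
  · refine absurd (fun ζ hζ => ?_) hg
    rw [hL] at hζ
    rcases hζ with rfl | rfl
    exacts [h1, h2]
  · exact ⟨h1, h2⟩
  · have := boundaryMap_injective g (h1.trans h2.symm)
    exact absurd (hne this (h1.trans this.symm)) hg

theorem IsLineal.index_limitFixer (h : IsLineal G Y) {s : G} (hs : s ∉ limitFixer G Y) :
    (limitFixer G Y).index = 2 := by
  obtain ⟨ξ, η, hne, hL⟩ := Set.encard_eq_two.1 h
  refine Subgroup.index_eq_two_iff.2 ⟨s, fun g => ?_⟩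
  rw [xor_iff_iff_not]
  by_cases hg : g ∈ limitFixer G Y
  · simpa [hg, Subgroup.mul_mem_cancel_left] using hs
  · simp only [hg, not_false_eq_true, iff_true]
    obtain ⟨a1, a2⟩ := boundaryMap_swap_of_notMem hL hg
    obtain ⟨b1, b2⟩ := boundaryMap_swap_of_notMem hL hs
    intro ζ hζ
    rw [hL] at hζ
    rw [boundaryMap_mul]
    rcases hζ with rfl | rfl
    · rw [b1, a2]
    · rw [b2, a1]

/-- A lineal action has a coarse coordinate along its orbits. -/
theorem IsLineal.exists_coordinate (h : IsLineal G Y) :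
    ∃ (y : Y) (C : ℝ) (b : G → ℝ), 0 ≤ C ∧
      (∀ g k : G, |orbitDist (actionMap G Y) y g k - lineDist b g k| ≤ C) ∧
      (∀ g k : G, g ∈ limitFixer G Y → |b (g * k) - b g - b k| ≤ C) ∧
      (∀ g k : G, g ∉ limitFixer G Y → |b (g * k) - b g + b k| ≤ C) ∧
      ∀ B, ∃ g, B < |b g| := by
  obtain ⟨ξ, η, hne, hL⟩ := Set.encard_eq_two.1 h
  obtain ⟨y, s, hs, hξ⟩ : ξ ∈ limitSet G Y := by rw [hL]; simp
  obtain ⟨-, s', -, hη⟩ : η ∈ limitSet G Y := by rw [hL]; simp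
  obtain ⟨δ, hδ, hY⟩ := IsHyperbolicSpace.hyperbolic (X := Y)
  have hY : FourPoint Y δ := hY
  have hss' : ¬ GromovConverges s.1 s'.1 := fun hc =>
    hne (by rw [hξ, hη]; exact (boundaryPoint_eq_iff _ _).2 hc)
  obtain ⟨R, hR⟩ := hY.exists_nearAxis hδ s.2 s'.2 hss' y
  have hfix : ∀ g ∈ limitFixer G Y, FixesEnds s.1 s'.1 g := fun g hg => by
    have h1 := hg ξ (by rw [hL]; simp)
    have h2 := hg η (by rw [hL]; simp)
    rw [hξ, boundaryMap_boundaryPoint_eq_iff] at h1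
    rw [hη, boundaryMap_boundaryPoint_eq_iff] at h2
    exact ⟨h1, h2⟩
  have hswap : ∀ g, g ∉ limitFixer G Y → SwapsEnds s.1 s'.1 g := fun g hg => by
    obtain ⟨h1, h2⟩ := boundaryMap_swap_of_notMem hL hg
    rw [hξ, hη, boundaryMap_boundaryPoint_eq_iff] at h1 h2
    exact ⟨h1, h2⟩
  obtain ⟨C, hC, hline, h1, h2⟩ := hY.exists_coarseLine hδ hR fun g =>
    (em (g ∈ limitFixer G Y)).imp (hfix g) (hswap g)
  refine ⟨y, C, fun g => busemann s.1 y (g • y), hC, hline, fun g k hg => h1 g k (hfix g hg),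
    fun g k hg => h2 g k (hswap g hg), fun B => ?_⟩
  obtain ⟨n, hn⟩ := ((s.2.tendsto_diag y).eventually_gt_atTop
    (B + C + |busemann s.1 y y|)).exists
  obtain ⟨g, hg⟩ := hs n
  refine ⟨g, ?_⟩
  have h3 := abs_le.1 (hline g 1)
  have h4 := abs_sub (busemann s.1 y (g • y)) (busemann s.1 y y)
  have hg : g • y = s.1 n := hg
  rw [gromovProduct_self, ← hg, dist_comm] at hn
  rw [one_smul] at h3
  linarith

end Lineal

/-! ### Actions on the real line -/

section RealLine

variable {G : Type u} [Group G]

/-- The action `g • x = σ g * x + c g` on the real line. -/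
abbrev signedAction (σ c : G → ℝ) (hσ1 : σ 1 = 1) (hc1 : c 1 = 0)
    (hσ : ∀ g k, σ (g * k) = σ g * σ k) (hc : ∀ g k, c (g * k) = σ g * c k + c g) :
    MulAction G ℝ where
  smul g x := σ g * x + c g
  one_smul x := by
    change σ 1 * x + c 1 = x
    rw [hσ1, hc1]; ring
  mul_smul g k x := by
    change σ (g * k) * x + c (g * k) = σ g * (σ k * x + c k) + c g
    rw [hσ, hc]; ring

theorem isIsometricSMul_of_affine [MulAction G ℝ] {σ c : G → ℝ} (hσ : ∀ g, |σ g| = 1)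
    (hact : ∀ (g : G) (x : ℝ), g • x = σ g * x + c g) : IsIsometricSMul G ℝ :=
  ⟨fun g => Isometry.of_dist_eq fun x y => by
    rw [hact, hact, Real.dist_eq, Real.dist_eq, add_sub_add_right_eq_sub, ← mul_sub, abs_mul, hσ,
      one_mul]⟩

/-- A coarse inverse of the coordinate: `x` goes to the orbit point of an element `s x` with `c (s
x)` near `x`. Because `c` satisfies the exact cocycle rule, `s (g • x)` and `g * s x` have nearby
coordinates, giving coarse equivariance. -/
theorem reducesTo_line {X : Type v} [MetricSpace X] {α : G → X → X} {Y : Type w} [MetricSpace Y]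
    [MulAction G Y] (hY : ReducesTo α (actionMap G Y)) {y : Y} {b : G → ℝ} {C : ℝ}
    (hline : ∀ g k : G, |orbitDist (actionMap G Y) y g k - lineDist b g k| ≤ C)
    [MulAction G ℝ] {σ c : G → ℝ} (hσ : ∀ g, |σ g| = 1)
    (hact : ∀ (g : G) (x : ℝ), g • x = σ g * x + c g) {C' : ℝ} (hbc : ∀ g, |b g - c g| ≤ C')
    {C'' : ℝ} (hdense : ∀ x, ∃ g, |c g - x| ≤ C'') : ReducesTo α (actionMap G ℝ) := by
  obtain ⟨F, ⟨K, ε, hF⟩, M, hM, hFM⟩ := hY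
  choose s hs using hdense
  have hK := hF.one_le
  have hε := hF.nonneg
  have hC : 0 ≤ C := (abs_nonneg _).trans (hline 1 1)
  have hC' : 0 ≤ C' := (abs_nonneg _).trans (hbc 1)
  have hC'' : 0 ≤ C'' := (abs_nonneg _).trans (hs 0)
  have hcmul : ∀ g k, c (g * k) = σ g * c k + c g := fun g k => by
    have h1 := mul_smul g k (0 : ℝ)
    simpa [hact] using h1
  have hclose : ∀ (g k : G) (x x' : ℝ), |c g - x| ≤ C'' → |c k - x'| ≤ C'' →
      |dist (g • y) (k • y) - dist x x'| ≤ C + 2 * C' + 2 * C'' := fun g k x x' hg hk => by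
    have h1 := abs_le.1 (hline g k)
    have h2 := abs_le.1 (abs_abs_sub_abs_le (b g - b k) (x - x'))
    have h3 : |b g - b k - (x - x')| ≤ 2 * C' + 2 * C'' := by
      have e1 := abs_le.1 (hbc g)
      have e2 := abs_le.1 (hbc k)
      rw [abs_le] at *
      constructor <;> linarith
    simp only [orbitDist, actionMap, lineDist] at h1
    rw [Real.dist_eq, abs_le]
    constructor <;> linarith
  refine ⟨fun x => F (s x • y), ⟨K, K * (C + 2 * C' + 2 * C'') + ε, ⟨hK, by positivity,
    fun x x' => ?_, fun x x' => ?_⟩⟩, K * (C + 2 * C' + 2 * C'') + ε + M, by positivity,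
    fun g x => ?_⟩
  · have h1 := hF.lower (s x • y) (s x' • y)
    have h2 := abs_le.1 (hclose _ _ x x' (hs x) (hs x'))
    have h3 : (1 / K) * (dist x x' - (C + 2 * C' + 2 * C'')) ≤
        (1 / K) * dist (s x • y) (s x' • y) := by
      gcongr; linarith
    have h4 : (1 / K) * (C + 2 * C' + 2 * C'') ≤ K * (C + 2 * C' + 2 * C'') := by
      gcongr
      exact ((div_le_one (by linarith)).2 hK).trans hK
    linarith
  · have h1 := hF.upper (s x • y) (s x' • y)
    have h2 := abs_le.1 (hclose _ _ x x' (hs x) (hs x'))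
    have h3 : K * dist (s x • y) (s x' • y) ≤ K * (dist x x' + (C + 2 * C' + 2 * C'')) := by
      gcongr; linarith
    linarith
  · have h1 := hFM g (s x • y)
    have h2 := hF.upper (s (g • x) • y) (g • s x • y)
    have h3 : |c (g * s x) - g • x| ≤ C'' := by
      rw [hcmul, hact, add_sub_add_right_eq_sub, ← mul_sub, abs_mul, hσ, one_mul]
      exact hs x
    have h4 := abs_le.1 (hclose _ _ _ _ (hs (g • x)) h3)
    rw [dist_self, sub_zero, mul_smul] at h4
    have h5 : K * dist (s (g • x) • y) (g • s x • y) ≤ K * (C + 2 * C' + 2 * C'') := by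
      gcongr; linarith
    have h6 := dist_triangle (F (s (g • x) • y)) (F (g • s x • y)) (α g (F (s x • y)))
    simp only [actionMap] at h1 ⊢
    linarith

theorem exists_abs_hom_sub_le {H : Type*} [Group H] (c : H →* Multiplicative ℝ) {h₀ : H}
    (h₀c : (c h₀).toAdd ≠ 0) (x : ℝ) : ∃ h, |(c h).toAdd - x| ≤ |(c h₀).toAdd| := by
  set r := (c h₀).toAdd with hr
  refine ⟨h₀ ^ ⌊x / r⌋, ?_⟩
  rw [map_zpow, toAdd_zpow, ← hr, zsmul_eq_mul]
  have h1 : (⌊x / r⌋ : ℝ) * r - x = -(Int.fract (x / r)) * r := by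
    rw [Int.fract]; field_simp; ring
  rw [h1, abs_mul, abs_neg, abs_of_nonneg (Int.fract_nonneg _)]
  exact mul_le_of_le_one_left (abs_nonneg _) (Int.fract_lt_one _).le

theorem isElliptic_iff_translation [MulAction G ℝ] {θ : G →* Multiplicative ℝ} {g : G}
    (h : ∀ n : ℤ, (g ^ n) • (0 : ℝ) = (θ (g ^ n)).toAdd) :
    BoundedPowers (orbitDist (actionMap G ℝ) 0) g ↔ g ∈ θ.ker := by
  rw [mem_ker_iff_bounded]
  simp only [BoundedPowers, orbitDist, actionMap, one_smul, Real.dist_eq, sub_zero, h]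

end RealLine

/-! ### Dihedral actions and their elliptic elements -/

section Dihedral

variable {G : Type u} [Group G] {H : Subgroup G}

/-- The affine action on the real line of a group with an index `2` subgroup `H` that acts by the
translations `e`, where the element `s ∉ H` acts by the reflection in `0`. -/
theorem exists_dihedral_action (hH : H.index = 2) {s : G} (hs : s ∉ H) (e : H →* Multiplicative ℝ)
    (hanti : ∀ h h' : H, ∀ r : G, r ∉ H → (h' : G) = r * h * r⁻¹ → (e h').toAdd = -(e h).toAdd) :
    ∃ (σ c : G → ℝ) (_ : MulAction G ℝ), (∀ g, |σ g| = 1) ∧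
      (∀ (g : G) (x : ℝ), g • x = σ g * x + c g) ∧
      ∀ h : H, σ h = 1 ∧ c h = (e h).toAdd ∧ σ (s * h) = -1 ∧ c (s * h) = -(e h).toAdd := by
  classical
  have hmem : ∀ {a b : G}, a * b ∈ H ↔ (a ∈ H ↔ b ∈ H) := Subgroup.mul_mem_iff_of_index_two hH
  set f : G → ℝ := fun g => if h : g ∈ H then (e ⟨g, h⟩).toAdd else 0 with hf
  have hfH : ∀ h : H, f h = (e h).toAdd := fun h => dif_pos h.2
  have hfmul : ∀ a ∈ H, ∀ b ∈ H, f (a * b) = f a + f b := fun a ha b hb => by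
    have h1 := hfH (⟨a, ha⟩ * ⟨b, hb⟩)
    rw [map_mul, toAdd_mul, ← hfH, ← hfH] at h1
    exact h1
  have hfanti : ∀ a ∈ H, ∀ r ∉ H, f (r * a * r⁻¹) = -f a := fun a ha r hr => by
    have hmem' : r * a * r⁻¹ ∈ H := by simp [hmem, ha, hr]
    have h1 := hanti ⟨a, ha⟩ ⟨_, hmem'⟩ r hr rfl
    rw [← hfH, ← hfH] at h1
    exact h1
  have hss : s * s ∈ H := by simp [hmem]
  -- `s` commutes with `s²`, so antisymmetry forces `f (s²)` to be its own negative. This is why `s`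
  -- can act as an honest reflection.
  have hfss : f (s * s) = 0 := by
    have := hfanti _ hss s hs
    rw [show s * (s * s) * s⁻¹ = s * s by group] at this
    linarith
  have hs' : s⁻¹ ∉ H := by simpa using hs
  have hf1 : f 1 = 0 := by
    have := hfmul 1 H.one_mem 1 H.one_mem
    rw [mul_one] at this
    linarith
  set σ : G → ℝ := fun g => if g ∈ H then 1 else -1 with hσ
  set c : G → ℝ := fun g => if g ∈ H then f g else -f (s⁻¹ * g) with hc
  have hσ1 : ∀ g ∈ H, σ g = 1 := fun g hg => if_pos hg
  have hσ2 : ∀ g, g ∉ H → σ g = -1 := fun g hg => if_neg hg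
  have hc1 : ∀ g ∈ H, c g = f g := fun g hg => if_pos hg
  have hc2 : ∀ g, g ∉ H → c g = -f (s⁻¹ * g) := fun g hg => if_neg hg
  have hσmul : ∀ g k, σ (g * k) = σ g * σ k := fun g k => by
    by_cases hg : g ∈ H <;> by_cases hk : k ∈ H <;> simp [hσ, hmem, hg, hk]
  have hcmul : ∀ g k, c (g * k) = σ g * c k + c g := fun g k => by
    by_cases hg : g ∈ H <;> by_cases hk : k ∈ H
    · rw [hc1 _ (H.mul_mem hg hk), hσ1 g hg, hc1 g hg, hc1 k hk, hfmul g hg k hk]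
      ring
    · have hgk : g * k ∉ H := by simp [hmem, hg, hk]
      have e1 : s⁻¹ * (g * k) = s⁻¹ * g * s⁻¹⁻¹ * (s⁻¹ * k) := by group
      have h1 : s⁻¹ * g * s⁻¹⁻¹ ∈ H := by simp [hmem, hg, hs]
      have h2 : s⁻¹ * k ∈ H := by simp [hmem, hk, hs]
      rw [hc2 _ hgk, hσ1 g hg, hc1 g hg, hc2 k hk, e1, hfmul _ h1 _ h2, hfanti g hg _ hs']
      ring
    · have hgk : g * k ∉ H := by simp [hmem, hg, hk]
      have h1 : s⁻¹ * g ∈ H := by simp [hmem, hg, hs]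
      rw [hc2 _ hgk, hσ2 g hg, hc2 g hg, hc1 k hk, ← mul_assoc, hfmul _ h1 _ hk]
      ring
    · have hgk : g * k ∈ H := by simp [hmem, hg, hk]
      have e1 : g * k = s * (s⁻¹ * g) * s⁻¹ * (s * s * (s⁻¹ * k)) := by group
      have h1 : s⁻¹ * g ∈ H := by simp [hmem, hg, hs]
      have h2 : s⁻¹ * k ∈ H := by simp [hmem, hk, hs]
      have h3 : s * (s⁻¹ * g) * s⁻¹ ∈ H := by simp [hmem, hg, hs]
      rw [hc1 _ hgk, hσ2 g hg, hc2 g hg, hc2 k hk, e1, hfmul _ h3 _ (H.mul_mem hss h2),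
        hfmul _ hss _ h2, hfss, hfanti _ h1 s hs]
      ring
  refine ⟨σ, c, signedAction σ c (hσ1 1 H.one_mem) ((hc1 1 H.one_mem).trans hf1) hσmul hcmul,
    fun g => ?_, fun g x => rfl, fun h => ?_⟩
  · by_cases hg : g ∈ H <;> simp [hσ, hg]
  · have hsh : s * h ∉ H := by simp [hmem, hs]
    refine ⟨hσ1 _ h.2, (hc1 _ h.2).trans (hfH h), hσ2 _ hsh, ?_⟩
    rw [hc2 _ hsh, inv_mul_cancel_left, hfH]

/-- Elements outside `E` lie in both subgroups. For `x ∈ H' ∩ E` the product `x * g₀` has the same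
nonzero `θ` as `g₀`, so it is outside `E` and hence in `H`; thus `x ∈ H`. -/
theorem subgroup_eq_of_elliptic {H H' : Subgroup G} (hH : H.index = 2) (hH' : H'.index = 2)
    {E : Set G} (hE : (H : Set G)ᶜ ⊆ E) {θ : H' →* Multiplicative ℝ}
    (hθ : E = (θ.ker.map H'.subtype : Set G) ∪ (H' : Set G)ᶜ) {g₀ : G} (hg₀ : g₀ ∉ E) :
    H' = H := by
  have hle : H' ≤ H := by
    have hout : ∀ g, g ∉ E → g ∈ H := fun g hg => by
      by_contra h
      exact hg (hE h)
    have hg₀' : g₀ ∈ H' := by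
      by_contra h
      exact hg₀ (hθ ▸ Or.inr h)
    have hg₀θ : (⟨g₀, hg₀'⟩ : H') ∉ θ.ker := fun h => hg₀ (hθ ▸ Or.inl ⟨_, h, rfl⟩)
    intro x hx
    by_cases hxE : x ∈ E
    · have hxθ : (⟨x, hx⟩ : H') ∈ θ.ker := by
        rw [hθ] at hxE
        rcases hxE with ⟨k, hk, rfl⟩ | h
        · exact hk
        · exact absurd hx h
      have hmul : x * g₀ ∉ E := by
        rw [hθ]
        rintro (⟨k, hk, hkx⟩ | h)
        · have : k = ⟨x, hx⟩ * ⟨g₀, hg₀'⟩ := Subtype.ext hkx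
          rw [this] at hk
          exact hg₀θ ((θ.ker.mul_mem_cancel_left hxθ).1 hk)
        · exact h (H'.mul_mem hx hg₀')
      exact (H.mul_mem_cancel_right (hout g₀ hg₀)).1 (hout _ hmul)
    · exact hout x hxE
  refine le_antisymm hle (Subgroup.relIndex_eq_one.1 ?_)
  have := Subgroup.relIndex_mul_index hle
  rw [hH, hH'] at this
  omega

/-- Dihedral actions have as elliptic elements the kernel of the translation homomorphism and
the elements outside the translation subgroup. -/
theorem boundedPowers_dihedral_iff [MulAction G ℝ] (hH : H.index = 2)
    {θ : H →* Multiplicative ℝ} {s : G} (hs : s ∉ H)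
    (hact : ∀ (h : H) (x : ℝ), (h : G) • x = x + (θ h).toAdd ∧
      (s * (h : G)) • x = -x - (θ h).toAdd) (g : G) :
    BoundedPowers (orbitDist (actionMap G ℝ) 0) g ↔
      g ∈ (θ.ker.map H.subtype : Set G) ∪ (H : Set G)ᶜ := by
  by_cases hg : g ∈ H
  · have h1 : BoundedPowers (orbitDist (actionMap G ℝ) 0) g ↔ (⟨g, hg⟩ : H) ∈ θ.ker := by
      rw [mem_ker_iff_bounded]
      have h2 : ∀ n : ℤ, (g ^ n) • (0 : ℝ) = (θ (⟨g, hg⟩ ^ n)).toAdd := fun n => by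
        have := (hact (⟨g, hg⟩ ^ n) 0).1
        rwa [zero_add, Subgroup.coe_zpow] at this
      simp only [BoundedPowers, orbitDist, actionMap, one_smul, Real.dist_eq, sub_zero, h2]
    rw [h1]
    constructor
    · exact fun h => Or.inl ⟨_, h, rfl⟩
    · rintro (⟨k, hk, rfl⟩ | h)
      · exact hk
      · exact absurd hg h
  · refine iff_of_true ?_ (Or.inr hg)
    have hsg : s⁻¹ * g ∈ H := by simp [Subgroup.mul_mem_iff_of_index_two hH, hs, hg]
    have hgx : ∀ x : ℝ, g • x = -x - (θ ⟨_, hsg⟩).toAdd := fun x => by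
      have := (hact ⟨_, hsg⟩ x).2
      rwa [mul_inv_cancel_left] at this
    have hgg : ∀ k : ℤ, (g ^ (k + k)) • (0 : ℝ) = 0 := fun k => by
      rw [← two_mul, zpow_mul]
      have : g ^ (2 : ℤ) ∈ MulAction.stabilizer G (0 : ℝ) := by
        rw [MulAction.mem_stabilizer_iff, zpow_two, mul_smul, hgx, hgx]
        ring
      exact MulAction.mem_stabilizer_iff.1 (Subgroup.zpow_mem _ this k)
    refine ⟨|(θ ⟨_, hsg⟩).toAdd|, fun n => ?_⟩
    simp only [orbitDist, actionMap, one_smul, Real.dist_eq, sub_zero]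
    rcases Int.even_or_odd' n with ⟨k, rfl | rfl⟩
    · rw [two_mul, hgg]
      simp
    · rw [two_mul, add_comm, zpow_add, mul_smul, hgg, zpow_one, hgx]
      simp

end Dihedral

/-! ### The two cases of the theorem -/

section Main

variable {G : Type u} [Group G]

theorem IsQuasimorphism.exists_unbounded {H : Type*} [Group H] {C : ℝ} {b : H → ℝ}
    (hb : IsQuasimorphism C b) (hub : ∀ B, ∃ g, B < |b g|) :
    ∃ g, ¬ ∃ B, ∀ n : ℤ, |b (g ^ n)| ≤ B := by
  obtain ⟨g, hg⟩ := hub C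
  refine ⟨g, fun ⟨B, hB⟩ => hg.not_ge (hb.abs_le_of_pow_le (B := B) fun n => ?_)⟩
  simpa using hB n

theorem ReducesTo.isElliptic_iff_of_line {X : Type v} [MetricSpace X] {α : G → X → X}
    (hα : IsQuasiAction α) {Y : Type w} [MetricSpace Y] [MulAction G Y]
    (hY : ReducesTo α (actionMap G Y)) {y : Y} {b : G → ℝ} {C : ℝ} (hC : 0 ≤ C)
    (hline : ∀ g k : G, |orbitDist (actionMap G Y) y g k - lineDist b g k| ≤ C) (g : G) :
    IsElliptic α g ↔ ∃ B, ∀ n : ℤ, |b (g ^ n)| ≤ B := by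
  have hcmp := coarselyLE_of_abs_sub_le hC hline
  rw [hY.isElliptic_iff hα y, ← boundedPowers_lineDist_iff]
  exact ⟨BoundedPowers.mono hcmp.2, BoundedPowers.mono hcmp.1⟩

theorem ReducesTo.coarselyLE_lineDist {X : Type v} [MetricSpace X] {α : G → X → X}
    (hα : IsQuasiAction α) {Y : Type w} [MetricSpace Y] [MulAction G Y]
    (hY : ReducesTo α (actionMap G Y)) {y : Y} {b : G → ℝ} {C : ℝ} (hC : 0 ≤ C)
    (hline : ∀ g k : G, |orbitDist (actionMap G Y) y g k - lineDist b g k| ≤ C)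
    {Z : Type t} [MetricSpace Z] [MulAction G Z] (hZ : ReducesTo α (actionMap G Z)) (z : Z) :
    CoarselyLE (orbitDist (actionMap G Z) z) (lineDist b) ∧
      CoarselyLE (lineDist b) (orbitDist (actionMap G Z) z) := by
  have hcmp := coarselyLE_of_abs_sub_le hC hline
  obtain ⟨F, -⟩ := id hZ
  have h1 := hZ.coarselyLE hα (F z) z
  have h2 := hY.coarselyLE hα (F z) y
  exact ⟨h1.2.trans (h2.1.trans hcmp.1), hcmp.2.trans (h2.2.trans h1.1)⟩

theorem translation_reduction_of_typeThreePlus {X : Type v} [MetricSpace X]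
    (α : G → X → X) (hα : IsQuasiAction α)
    {Y : Type w} [MetricSpace Y] [IsHyperbolicSpace Y] [MulAction G Y] [IsIsometricSMul G Y]
    (hY : ReducesTo α (actionMap G Y)) (h3 : IsTypeThreePlus G Y) :
    ((∃ (_ : MulAction G ℝ) (_ : IsIsometricSMul G ℝ),
          IsTranslationAction G ∧ ReducesTo α (actionMap G ℝ)) ↔
        ∃ θ : G →* Multiplicative ℝ, {g : G | IsElliptic α g} = (θ.ker : Set G)) ∧
      ((¬ ∃ θ : G →* Multiplicative ℝ, {g : G | IsElliptic α g} = (θ.ker : Set G)) →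
        ∀ (Z : Type t) [MetricSpace Z] [IsHyperbolicSpace Z] [MulAction G Z]
          [IsIsometricSMul G Z], (ProperSpace Z ∨ IsCAT0Space Z) →
          ¬ ReducesTo α (actionMap G Z)) := by
  obtain ⟨hlin, hfix⟩ := h3
  obtain ⟨y, C, b, hC, hline, hquasi, -, hub⟩ := hlin.exists_coordinate
  have hb : IsQuasimorphism C b := fun g k => hquasi g k (hfix g)
  have hell := hY.isElliptic_iff_of_line hα hC hline
  refine ⟨⟨?_, ?_⟩, ?_⟩
  · rintro ⟨_, _, ⟨θ, hθ⟩, hred⟩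
    refine ⟨θ, Set.ext fun g => ?_⟩
    rw [Set.mem_ofPred_eq, hred.isElliptic_iff hα 0]
    exact isElliptic_iff_translation fun n => by rw [hθ, zero_add]
  · rintro ⟨θ, hθ⟩
    have hmem : ∀ g, g ∈ θ.ker ↔ ∃ B, ∀ n : ℤ, |b (g ^ n)| ≤ B := fun g => by
      rw [← hell]
      exact (Set.ext_iff.1 hθ g).symm
    obtain ⟨c, hc⟩ := hb.exists_hom_of_ker θ fun g hg => by
      obtain ⟨B, hB⟩ := (hmem g).1 hg
      exact ⟨B, fun n => by simpa using hB n⟩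
    obtain ⟨g₀, hg₀⟩ : ∃ g₀, (c g₀).toAdd ≠ 0 := by
      obtain ⟨g, hg⟩ := hub (2 * C)
      refine ⟨g, fun h0 => ?_⟩
      have := hc g
      rw [h0, sub_zero] at this
      linarith
    let act : MulAction G ℝ := signedAction (fun _ => 1) (fun g => (c g).toAdd) rfl (by simp)
      (by simp) (fun g k => by rw [map_mul, toAdd_mul]; ring)
    have hact : ∀ (g : G) (x : ℝ), g • x = 1 * x + (c g).toAdd := fun g x => rfl
    refine ⟨act, isIsometricSMul_of_affine (σ := fun _ => 1) (by simp) hact,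
      ⟨c, fun g x => by rw [hact, one_mul]⟩, ?_⟩
    exact reducesTo_line hY hline (σ := fun _ => 1) (by simp) hact hc
      (exists_abs_hom_sub_le c hg₀)
  · intro hno Z _ _ _ _ hZ hred
    obtain ⟨z⟩ := IsHyperbolicSpace.nonempty (X := Z)
    obtain ⟨h1, h2⟩ := hY.coarselyLE_lineDist hα hC hline hred z
    obtain ⟨θ, hθ⟩ := exists_hom_of_coarselyLE hZ z hb hub h1 h2
    refine hno ⟨θ, Set.ext fun g => ?_⟩
    rw [Set.mem_ofPred_eq, hred.isElliptic_iff hα z]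
    exact (hθ g).symm

theorem dihedral_reduction_of_typeThreeMinus {X : Type v} [MetricSpace X]
    (α : G → X → X) (hα : IsQuasiAction α)
    {Y : Type w} [MetricSpace Y] [IsHyperbolicSpace Y] [MulAction G Y] [IsIsometricSMul G Y]
    (hY : ReducesTo α (actionMap G Y)) (h3 : IsTypeThreeMinus G Y) :
    ((∃ (_ : MulAction G ℝ) (_ : IsIsometricSMul G ℝ),
          IsDihedralAction G ∧ ReducesTo α (actionMap G ℝ)) ↔
        ∃ (H : Subgroup G) (θ : H →* Multiplicative ℝ), H.index = 2 ∧
          {g : G | IsElliptic α g} = (θ.ker.map H.subtype : Set G) ∪ (H : Set G)ᶜ) ∧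
      ((¬ ∃ (H : Subgroup G) (θ : H →* Multiplicative ℝ), H.index = 2 ∧
          {g : G | IsElliptic α g} = (θ.ker.map H.subtype : Set G) ∪ (H : Set G)ᶜ) →
        ∀ (Z : Type t) [MetricSpace Z] [IsHyperbolicSpace Z] [MulAction G Z]
          [IsIsometricSMul G Z], (ProperSpace Z ∨ IsCAT0Space Z) →
          ¬ ReducesTo α (actionMap G Z)) := by
  obtain ⟨hlin, hswap⟩ := h3
  obtain ⟨y, C, b, hC, hline, hquasi, hanti, hub⟩ := hlin.exists_coordinate
  obtain ⟨s, hs⟩ : ∃ s, s ∉ limitFixer G Y := not_forall.1 hswap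
  have hindex := hlin.index_limitFixer hs
  set H := limitFixer G Y with hH
  have hmem2 : ∀ {a b : G}, a * b ∈ H ↔ (a ∈ H ↔ b ∈ H) :=
    Subgroup.mul_mem_iff_of_index_two hindex
  have hb : IsQuasimorphism C fun h : H => b h := fun g k => hquasi g k g.2
  have hell := hY.isElliptic_iff_of_line hα hC hline
  -- An element outside `H` is multiplied by `s` into `H`, changing `|b|` by at most `C + |b s|`.
  have hubH : ∀ B, ∃ h : H, B < |b h| := fun B => by
    obtain ⟨g, hg⟩ := hub (B + C + |b s| )
    by_cases hgH : g ∈ H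
    · exact ⟨⟨g, hgH⟩, by linarith [abs_nonneg (b s)]⟩
    · refine ⟨⟨s * g, by simp [hmem2, hs, hgH]⟩, ?_⟩
      have h1 := hanti s g hs
      have h2 := abs_sub_abs_le_abs_sub (b g) (-(b (s * g) - b s))
      have h3 := abs_sub (b (s * g)) (b s)
      rw [abs_neg, sub_neg_eq_add, add_comm (b g)] at h2
      linarith
  have hconj : ∀ r ∉ H, ∀ k ∈ H, |b (r * k * r⁻¹) + b k| ≤ 2 * C + |b r| + |b r⁻¹| := by
    intro r hr k hk
    have h1 := abs_le.1 (hanti r (k * r⁻¹) hr)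
    have h2 := abs_le.1 (hquasi k r⁻¹ hk)
    have h3 := neg_abs_le (b r)
    have h4 := le_abs_self (b r)
    have h5 := neg_abs_le (b r⁻¹)
    have h6 := le_abs_self (b r⁻¹)
    rw [mul_assoc, abs_le]
    constructor <;> linarith
  -- `g` commutes with its even powers but conjugation by `g` coarsely negates `b`, so `b` is
  -- bounded on them; odd powers differ by one factor `g`.
  have hout : ∀ g ∉ H, ∃ B, ∀ n : ℤ, |b (g ^ n)| ≤ B := fun g hg => by
    have h1 : ∀ k : ℤ, |b (g ^ (k + k))| ≤ 2 * C + |b g| + |b g⁻¹| := fun k => by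
      have hk : g ^ (k + k) ∈ H := by rw [zpow_add]; simp [hmem2]
      have h2 := hconj g hg _ hk
      have h3 : g * g ^ (k + k) * g⁻¹ = g ^ (k + k) := by group
      rw [h3, ← two_mul, abs_mul, abs_two] at h2
      linarith [abs_nonneg (b (g ^ (k + k)))]
    refine ⟨2 * (2 * C + |b g| + |b g⁻¹|), fun n => ?_⟩
    have h0 := abs_nonneg (b g⁻¹)
    have h0' := abs_nonneg (b g)
    rcases Int.even_or_odd' n with ⟨k, rfl | rfl⟩
    · rw [two_mul]
      exact (h1 k).trans (by linarith)
    · have h2 := abs_le.1 (h1 k)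
      have h3 := abs_le.1 (hanti g (g ^ (k + k)) hg)
      have h4 := neg_abs_le (b g)
      have h5 := le_abs_self (b g)
      rw [two_mul, add_comm, zpow_add, zpow_one, abs_le]
      constructor <;> linarith
  have hcompl : (H : Set G)ᶜ ⊆ {g : G | IsElliptic α g} := fun g hg => (hell g).2 (hout g hg)
  refine ⟨⟨?_, ?_⟩, ?_⟩
  · rintro ⟨_, _, ⟨H', θ, r, hH', hr, -, hact⟩, hred⟩
    refine ⟨H', θ, hH', Set.ext fun g => ?_⟩
    rw [Set.mem_ofPred_eq, hred.isElliptic_iff hα 0]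
    exact boundedPowers_dihedral_iff hH' hr hact g
  · rintro ⟨H', θ, hH', hθ⟩
    obtain ⟨g₀, hg₀⟩ := hb.exists_unbounded hubH
    obtain rfl : H' = H := subgroup_eq_of_elliptic hindex hH' hcompl hθ
      (g₀ := g₀) fun h => hg₀ (by simpa using (hell g₀).1 h)
    obtain ⟨c, hc⟩ := hb.exists_hom_of_ker θ fun g hg => by
      have : (g : G) ∈ {g : G | IsElliptic α g} := by
        rw [hθ]
        exact Or.inl ⟨g, hg, rfl⟩
      obtain ⟨B, hB⟩ := (hell g).1 this
      exact ⟨B, fun n => by simpa using hB n⟩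
    have hcanti : ∀ h h' : H, ∀ r : G, r ∉ H → (h' : G) = r * h * r⁻¹ →
        (c h').toAdd = -(c h).toAdd := by
      intro h h' r hr hh'
      -- Conjugation gives antisymmetry of `c` only up to a constant; multiples of the error stay
      -- bounded because `c` is a homomorphism, so the error is zero. The `4C` is `2C` for each
      -- replacement of `b` by `c`.
      have hpow : ∀ n : ℕ, |n * ((c h').toAdd + (c h).toAdd)| ≤
          2 * C + |b r| + |b r⁻¹| + 4 * C := fun n => by
        have h1 := hconj r hr (h ^ n : H) (h ^ n).2
        have h2 : r * ((h ^ n : H) : G) * r⁻¹ = ((h' ^ n : H) : G) := by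
          rw [Subgroup.coe_pow, Subgroup.coe_pow, hh', conj_pow]
        rw [h2] at h1
        have h3 := hc (h ^ n)
        have h4 := hc (h' ^ n)
        rw [map_pow, toAdd_pow, nsmul_eq_mul] at h3 h4
        rw [mul_add]
        rw [abs_le] at *
        constructor <;> linarith
      by_contra hne
      have hne' : 0 < |(c h').toAdd + (c h).toAdd| :=
        abs_pos.2 fun h0 => hne (eq_neg_of_add_eq_zero_left h0)
      obtain ⟨n, hn⟩ := exists_nat_gt ((2 * C + |b r| + |b r⁻¹| + 4 * C) /
        |(c h').toAdd + (c h).toAdd|)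
      rw [div_lt_iff₀ hne'] at hn
      have := hpow n
      rw [abs_mul, Nat.abs_cast] at this
      linarith
    obtain ⟨σ, f, act, hσ, hact, hσf⟩ := exists_dihedral_action hindex hs c hcanti
    obtain ⟨h₀, hh₀⟩ : ∃ h₀, (c h₀).toAdd ≠ 0 := by
      obtain ⟨g, hg⟩ := hubH (2 * C)
      refine ⟨g, fun h0 => ?_⟩
      have := hc g
      rw [h0, sub_zero] at this
      linarith
    refine ⟨act, isIsometricSMul_of_affine hσ hact,
      ⟨H, c, s, hindex, hs, hcanti, fun h x => ?_⟩, ?_⟩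
    · obtain ⟨h1, h2, h3, h4⟩ := hσf h
      rw [hact, hact, h1, h2, h3, h4]
      constructor <;> ring
    -- Outside `H`, writing `g = s * h` costs `|b s| + C` by coarse reflection and `2C` for passing
    -- from `b h` to `c h`.
    · refine reducesTo_line hY hline hσ hact (C' := |b s| + 3 * C) (fun g => ?_)
        (C'' := |(c h₀).toAdd|) (fun x => ?_)
      · by_cases hg : g ∈ H
        · have h1 := (hσf ⟨g, hg⟩).2.1
          rw [show f g = _ from h1]
          exact (hc ⟨g, hg⟩).trans (by linarith [abs_nonneg (b s)])
        · have hsg : s⁻¹ * g ∈ H := by simp [hmem2, hs, hg]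
          have h1 := (hσf ⟨_, hsg⟩).2.2.2
          have h2 := abs_le.1 (hc ⟨_, hsg⟩)
          have h3 := abs_le.1 (hanti s (s⁻¹ * g) hs)
          have h4 := neg_abs_le (b s)
          have h5 := le_abs_self (b s)
          rw [mul_inv_cancel_left] at h1 h3
          rw [h1, abs_le]
          constructor <;> linarith
      · obtain ⟨h, hh⟩ := exists_abs_hom_sub_le c hh₀ x
        exact ⟨h, by rwa [(hσf h).2.1]⟩
  · intro hno Z _ _ _ _ hZ hred
    obtain ⟨z⟩ := IsHyperbolicSpace.nonempty (X := Z)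
    obtain ⟨⟨A, B, hA, hB, h1⟩, ⟨A', B', hA', hB', h2⟩⟩ :=
      hY.coarselyLE_lineDist hα hC hline hred z
    -- Only `H` acts by a quasimorphism, so the rigidity result is applied to the restricted action.
    have : IsIsometricSMul H Z := ⟨fun h => isometry_smul Z (h : G)⟩
    obtain ⟨θ, hθ⟩ := exists_hom_of_coarselyLE (G := H) hZ z hb hubH
      ⟨A, B, hA, hB, fun g k => h1 g k⟩ ⟨A', B', hA', hB', fun g k => h2 g k⟩
    refine hno ⟨H, θ, hindex, Set.ext fun g => ?_⟩
    by_cases hg : g ∈ H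
    · have h3 : IsElliptic α g ↔ (⟨g, hg⟩ : H) ∈ θ.ker := by
        rw [hθ, hred.isElliptic_iff hα z]
        rfl
      rw [Set.mem_ofPred_eq, h3]
      constructor
      · exact fun h => Or.inl ⟨_, h, rfl⟩
      · rintro (⟨k, hk, rfl⟩ | h)
        · exact hk
        · exact absurd hg h
    · exact iff_of_true (hcompl hg) (Or.inr hg)

end Main

theorem mainTheorem8 {G : Type u} [Group G] {X : Type v} [MetricSpace X]
    (α : G → X → X) (hα : IsQuasiAction α)
    {Y : Type w} [MetricSpace Y] [IsHyperbolicSpace Y] [MulAction G Y] [IsIsometricSMul G Y]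
    (hY : ReducesTo α (actionMap G Y)) :
    (IsTypeThreePlus G Y →
      ((∃ (_ : MulAction G ℝ) (_ : IsIsometricSMul G ℝ),
          IsTranslationAction G ∧ ReducesTo α (actionMap G ℝ)) ↔
        ∃ θ : G →* Multiplicative ℝ, {g : G | IsElliptic α g} = (θ.ker : Set G)) ∧
      ((¬ ∃ θ : G →* Multiplicative ℝ, {g : G | IsElliptic α g} = (θ.ker : Set G)) →
        ∀ (Z : Type t) [MetricSpace Z] [IsHyperbolicSpace Z] [MulAction G Z]
          [IsIsometricSMul G Z], (ProperSpace Z ∨ IsCAT0Space Z) →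
          ¬ ReducesTo α (actionMap G Z))) ∧
    (IsTypeThreeMinus G Y →
      ((∃ (_ : MulAction G ℝ) (_ : IsIsometricSMul G ℝ),
          IsDihedralAction G ∧ ReducesTo α (actionMap G ℝ)) ↔
        ∃ (H : Subgroup G) (θ : H →* Multiplicative ℝ), H.index = 2 ∧
          {g : G | IsElliptic α g} = (θ.ker.map H.subtype : Set G) ∪ (H : Set G)ᶜ) ∧
      ((¬ ∃ (H : Subgroup G) (θ : H →* Multiplicative ℝ), H.index = 2 ∧
          {g : G | IsElliptic α g} = (θ.ker.map H.subtype : Set G) ∪ (H : Set G)ᶜ) →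
        ∀ (Z : Type t) [MetricSpace Z] [IsHyperbolicSpace Z] [MulAction G Z]
          [IsIsometricSMul G Z], (ProperSpace Z ∨ IsCAT0Space Z) →
          ¬ ReducesTo α (actionMap G Z))) :=
  ⟨translation_reduction_of_typeThreePlus α hα hY, dihedral_reduction_of_typeThreeMinus α hα hY⟩
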